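/- Consider the Hunter-Saxton equation $$\partial_t u+\partial_x\Big[\tfrac12u^2\Big]=\tfrac12\int_{-\infty}^x w^2(y,t)\,dy,\qquad w=\partial_x u,\qquad u(x,0)=u_0(x). \tag{HS}$$ A continuous function $u$ on $\mathbb R\times[0,\infty)$ is a weak solution of (HS) with initial datum $u_0$, $u_0'=w_0$ a.e., $w_0\in L^2(\mathbb R)$, if $u(\cdot,t)$ is (locally) absolutely continuous on $\mathbb R$ for every $t\ge0$, $w=\partial_xu\in L^\infty([0,\infty);L^2(\mathbb R))$, the map $t\mapsto u(\cdot,t)\in L^2_{loc}(\mathbb R)$ is (locally) absolutely continuous on $[0,\infty)$, the equation holds in the sense of distributions (tested against $C_c^\infty(\mathbb R\times(0,\infty))$), and $u(x,0)=u_0(x)$ for all $x$. A characteristic on $[0,T]$ associated to $u$ and starting at $x_0$ is a Lipschitz function $x:[0,T]\to\mathbb R$ with $x(0)=x_0$ and $\dot x(t)=u(x(t),t)$ for a.e. $t\in[0,T]$. For $0<t<\infty$ let $$I_t=\{z\in\mathbb R:\ u_0'(z)\text{ exists},\ u_0'(z)=w_0(z),\ w_0(z)>-2/t\}.$$ **Proposition.**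 Let $u$ be a weak solution of (HS), let $\xi<\zeta$, let $T>0$, and let $x_\xi,x_\zeta$ be characteristics on $[0,T]$ associated to $u$ and starting at $\xi$ and $\zeta$ respectively, with $x_\xi(s)\le x_\zeta(s)$ for all $s\in[0,T]$. Then for every $t\in(0,T]$ the function $w^2(\cdot,t)$ is integrable on $[x_\xi(t),x_\zeta(t)]$ and $$\int_{x_\xi(t)}^{x_\zeta(t)}w^2(y,t)\,dy\ \ge\ \int_{I_t\cap(\xi,\zeta)}w_0^2(z)\,dz .$$ -/

import Mathlib

open MeasureTheory Set
open scoped ContDiff NNReal ENNReal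

/-- The spatial derivative `w(x,t) = ∂ₓ u(x,t)`. -/
noncomputable def spatialDeriv (u : ℝ → ℝ → ℝ) (x t : ℝ) : ℝ :=
  deriv (fun y => u y t) x

/-- The equation `∂ₜ u + ∂ₓ (u² / 2) = (1/2) ∫_{-∞}^x w²(y,t) dy` with `w = ∂ₓ u`, in the sense of
distributions on the open half plane `{(x,t) : t > 0}`: it is tested against all smooth functions
with compact support in that half plane. -/
def HunterSaxtonDistributional (u : ℝ → ℝ → ℝ) : Prop :=
  ∀ φ : ℝ × ℝ → ℝ, ContDiff ℝ ∞ φ → HasCompactSupport φ →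
    tsupport φ ⊆ {z : ℝ × ℝ | 0 < z.2} →
    ∫ t in Ioi (0 : ℝ), ∫ x : ℝ,
      (u x t * deriv (fun s => φ (x, s)) t
        + (1 / 2) * u x t ^ 2 * deriv (fun y => φ (y, t)) x
        + (1 / 2) * (∫ y in Iic x, spatialDeriv u y t ^ 2) * φ (x, t)) = 0

/-- `u` is a weak solution of the Hunter-Saxton equation on `ℝ × [0, ∞)` with initial datum `u₀`,
where `w₀` is the derivative of `u₀`. The values `u x t` with `t < 0` play no role. -/
structure IsHunterSaxtonWeakSolution (u : ℝ → ℝ → ℝ) (u₀ w₀ : ℝ → ℝ) : Prop where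
  continuous : ContinuousOn (fun z : ℝ × ℝ => u z.1 z.2) {z : ℝ × ℝ | 0 ≤ z.2}
  absolutelyContinuous_space : ∀ t : ℝ, 0 ≤ t → ∀ a b : ℝ,
    AbsolutelyContinuousOnInterval (fun x => u x t) a b
  /-- `w = ∂ₓ u` lies in `L^∞([0, ∞); L²(ℝ))`. -/
  deriv_bounded : ∃ C : ℝ≥0, ∀ᵐ t ∂(volume.restrict (Ici (0 : ℝ))),
    MemLp (fun x => spatialDeriv u x t) 2 volume ∧
      eLpNorm (fun x => spatialDeriv u x t) 2 volume ≤ (C : ℝ≥0∞)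
  /-- `t ↦ u(·,t)` is absolutely continuous with values in `L²_loc(ℝ)`. -/
  absolutelyContinuous_time : ∀ a b T : ℝ, 0 ≤ T →
    ∃ F : ℝ → Lp ℝ 2 (volume.restrict (Icc a b)),
      (∀ t ∈ Icc 0 T, F t =ᵐ[volume.restrict (Icc a b)] fun x => u x t) ∧
        AbsolutelyContinuousOnInterval F 0 T
  equation : HunterSaxtonDistributional u
  initial : ∀ x : ℝ, u x 0 = u₀ x
  initial_deriv : ∀ᵐ x : ℝ, HasDerivAt u₀ (w₀ x) x
  initial_memLp : MemLp w₀ 2 volume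

/-- `x` is a characteristic on `[0, T]` associated to `u`, starting at `x₀`. -/
structure IsCharacteristic (u : ℝ → ℝ → ℝ) (T x₀ : ℝ) (x : ℝ → ℝ) : Prop where
  lipschitz : ∃ K : ℝ≥0, LipschitzOnWith K x (Icc 0 T)
  start : x 0 = x₀
  hasDerivAt : ∀ᵐ t ∂(volume.restrict (Icc 0 T)), HasDerivAt x (u (x t) t) t

/-- The set `I_t` of points at which the derivative of `u₀` exists, equals `w₀` and exceeds
`-2 / t`; it is used for `0 < t < ∞` only. -/
def survivingSet (u₀ w₀ : ℝ → ℝ) (t : ℝ) : Set ℝ :=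
  {z : ℝ | HasDerivAt u₀ (w₀ z) z ∧ w₀ z > -2 / t}

open Filter Topology

/-! ### Absolutely continuous functions -/

/-! Formally `w` satisfies ∂ₜw + u ∂ₓw = -w²/2, so along characteristics it obeys the Riccati
equation v' = -v²/2, and an initial value above -2/t does not blow up by time t. If a function b(v,
s) satisfies ∂ₛb - (v²/2) ∂ᵥb + v b = 0, then ∂ₜ b(w, t) + ∂ₓ(u b(w, t)) = 0, so the integral of
b(w, s) between two characteristics is conserved (`integral_renorm_eq`). The function `renormFn` is
such a b. It satisfies 0 ≤ b ≤ v² and only sees values whose initial value lies in (-m, N). With m <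
2/τ these values stay in a compact set on [0, τ], so b is bounded there with its derivatives. At
time τ, b ≤ v² bounds the energy from below; at time 0, letting m ↑ 2/τ and N, c → ∞ recovers v² on
{v > -2/τ} and 0 elsewhere (`integral_surviving_le`).

Since `w` is only L² in space, the chain rule is applied to the forward quotient w_h = (u(x+h) -
u(x))/h. The equation holds in integrated form on almost every vertical line
(`ae_forall_eq_add_integral`), and the discrete Leibniz rule gives ∂ₜw_h + u(x+h) ∂ₓw_h = ½ mean(w²)
- w w_h. After composing with b, the failure of conservation is a residual. Its quadratic error is
half the mean of (w(x+k) - w(x))², which vanishes in L¹ because translations are continuous in L²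
(`lintegral_quotDefect_le`, `tendsto_lintegral_renormResidual`). The region between the
characteristics is replaced by a smooth strip moving with them; its edge terms are small by uniform
continuity of u (`lintegral_stripDt_add_le`). -/

theorem AbsolutelyContinuousOnInterval.prodMk {f g : ℝ → ℝ} {a b : ℝ}
    (hf : AbsolutelyContinuousOnInterval f a b) (hg : AbsolutelyContinuousOnInterval g a b) :
    AbsolutelyContinuousOnInterval (fun x => (f x, g x)) a b := by
  refine squeeze_zero (fun E => Finset.sum_nonneg fun i _ => dist_nonneg) (fun E => ?_)
    (by simpa using Tendsto.add hf hg)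
  rw [← Finset.sum_add_distrib]
  gcongr
  rw [Prod.dist_eq]
  exact max_le_add_of_nonneg dist_nonneg dist_nonneg

theorem AbsolutelyContinuousOnInterval.comp_lipschitzOnWith {X Y : Type*} [PseudoMetricSpace X]
    [PseudoMetricSpace Y] {Φ : X → Y} {p : ℝ → X} {a b : ℝ} {K : ℝ≥0} {S : Set X}
    (hp : AbsolutelyContinuousOnInterval p a b) (hΦ : LipschitzOnWith K Φ S)
    (hS : MapsTo p (uIcc a b) S) : AbsolutelyContinuousOnInterval (fun x => Φ (p x)) a b := by
  have h0 : Tendsto (fun E : ℕ × (ℕ → ℝ × ℝ) =>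
      (K : ℝ) * ∑ i ∈ Finset.range E.1, dist (p (E.2 i).1) (p (E.2 i).2))
      (AbsolutelyContinuousOnInterval.totalLengthFilter ⊓
        𝓟 (AbsolutelyContinuousOnInterval.disjWithin a b)) (𝓝 0) := by
    simpa using Tendsto.const_mul (K : ℝ) hp
  refine squeeze_zero' (Eventually.of_forall fun E => Finset.sum_nonneg fun i _ => dist_nonneg)
    ?_ h0
  rw [eventually_inf_principal]
  filter_upwards with E hE
  rw [Finset.mul_sum]
  refine Finset.sum_le_sum fun i hi => ?_
  exact hΦ.dist_le_mul _ (hS (hE.1 i hi).1) _ (hS (hE.1 i hi).2)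

/-- The path has bounded range, and a C¹ function is Lipschitz on a closed ball of a
finite-dimensional space. It is needed for s ↦ b(w_h(x, s), s). -/
theorem AbsolutelyContinuousOnInterval.comp_contDiff {E : Type*} [NormedAddCommGroup E]
    [NormedSpace ℝ E] [FiniteDimensional ℝ E] {Φ : E → ℝ} {p : ℝ → E} {a b : ℝ}
    (hp : AbsolutelyContinuousOnInterval p a b) (hΦ : ContDiff ℝ 1 Φ) :
    AbsolutelyContinuousOnInterval (fun x => Φ (p x)) a b := by
  have : ProperSpace E := FiniteDimensional.proper ℝ E
  obtain ⟨C, hC⟩ := isCompact_uIcc.exists_bound_of_continuousOn hp.continuousOn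
  obtain ⟨K, hK⟩ := (hΦ.contDiffOn (s := Metric.closedBall (0 : E) C)).exists_lipschitzOnWith
    (by decide) (convex_closedBall _ _) (isCompact_closedBall _ _)
  exact hp.comp_lipschitzOnWith hK fun x hx => by simpa using hC x hx

theorem AbsolutelyContinuousOnInterval.integral_eq_sub_of_ae_hasDerivAt {f f' : ℝ → ℝ} {a b : ℝ}
    (hf : AbsolutelyContinuousOnInterval f a b)
    (h : ∀ᵐ x, x ∈ uIoc a b → HasDerivAt f (f' x) x) : ∫ x in a..b, f' x = f b - f a := by
  rw [← hf.integral_deriv_eq_sub]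
  refine intervalIntegral.integral_congr_ae ?_
  filter_upwards [h] with x hx hx'
  exact (hx hx').deriv.symm

theorem AbsolutelyContinuousOnInterval.intervalIntegrable_of_ae_hasDerivAt {f f' : ℝ → ℝ}
    {a b : ℝ} (hf : AbsolutelyContinuousOnInterval f a b)
    (h : ∀ᵐ x, x ∈ uIoc a b → HasDerivAt f (f' x) x) : IntervalIntegrable f' volume a b := by
  refine hf.intervalIntegrable_deriv.congr_ae ?_
  rw [EventuallyEq, ae_restrict_iff' measurableSet_uIoc]
  filter_upwards [h] with x hx hx'
  exact (hx hx').deriv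

theorem absolutelyContinuousOnInterval_of_integral {f g : ℝ → ℝ} {a b : ℝ}
    (hg : IntervalIntegrable g volume a b)
    (h : ∀ t ∈ uIcc a b, f t = f a + ∫ s in a..t, g s) :
    AbsolutelyContinuousOnInterval f a b := by
  have h1 := hg.absolutelyContinuousOnInterval_intervalIntegral (c := a) left_mem_uIcc
  rw [absolutelyContinuousOnInterval_iff] at h1 ⊢
  intro ε hε
  obtain ⟨δ, hδ, H⟩ := h1 ε hε
  refine ⟨δ, hδ, fun E hE hE' => ?_⟩
  convert H E hE hE' using 1
  refine Finset.sum_congr rfl fun i hi => ?_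
  have h2 := hE.1 i hi
  rw [h _ h2.1, h _ h2.2, dist_add_left]

theorem AbsolutelyContinuousOnInterval.comp_add_right {f : ℝ → ℝ} {a b h : ℝ}
    (hf : AbsolutelyContinuousOnInterval f (a + h) (b + h)) :
    AbsolutelyContinuousOnInterval (fun x => f (x + h)) a b := by
  have hi : IntervalIntegrable (fun x => deriv f (x + h)) volume a b := by
    simpa using hf.intervalIntegrable_deriv.comp_add_right h
  refine absolutelyContinuousOnInterval_of_integral hi fun t ht => ?_
  have h1 : AbsolutelyContinuousOnInterval f (a + h) (t + h) := by
    refine hf.mono (uIcc_subset_uIcc left_mem_uIcc ?_)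
    rw [← image_add_const_uIcc]
    exact mem_image_of_mem _ ht
  rw [intervalIntegral.integral_comp_add_right, h1.integral_deriv_eq_sub]
  ring

theorem ae_hasDerivAt_of_integral {f g : ℝ → ℝ} {T : ℝ} (hT : 0 ≤ T)
    (hg : IntervalIntegrable g volume 0 T)
    (h : ∀ t ∈ Icc 0 T, f t = f 0 + ∫ s in (0 : ℝ)..t, g s) :
    ∀ᵐ t, t ∈ Ioo 0 T → HasDerivAt f (g t) t := by
  filter_upwards [hg.ae_hasDerivAt_integral] with t ht ht'
  have h1 := ht (by rw [uIcc_of_le hT]; exact Ioo_subset_Icc_self ht') 0 left_mem_uIcc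
  refine (h1.const_add (f 0)).congr_of_eventuallyEq ?_
  filter_upwards [Ioo_mem_nhds ht'.1 ht'.2] with s hs
  exact h s (Ioo_subset_Icc_self hs)

/-! ### A smooth cut-off -/

/-- A smooth monotone function vanishing on `(-∞, 0]` and equal to `1` on `[ε, ∞)`. -/
noncomputable def smoothCut (ε r : ℝ) : ℝ := Real.smoothTransition (r / ε)

section smoothCut

variable {ε : ℝ}

theorem contDiff_smoothCut {n : ℕ∞} : ContDiff ℝ n (smoothCut ε) :=
  Real.smoothTransition.contDiff.comp (contDiff_id.div_const ε)

theorem smoothCut_nonneg (r : ℝ) : 0 ≤ smoothCut ε r := Real.smoothTransition.nonneg _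

theorem smoothCut_le_one (r : ℝ) : smoothCut ε r ≤ 1 := Real.smoothTransition.le_one _

theorem smoothCut_of_nonpos (hε : 0 < ε) {r : ℝ} (hr : r ≤ 0) : smoothCut ε r = 0 :=
  Real.smoothTransition.zero_of_nonpos (div_nonpos_of_nonpos_of_nonneg hr hε.le)

theorem smoothCut_of_ge (hε : 0 < ε) {r : ℝ} (hr : ε ≤ r) : smoothCut ε r = 1 :=
  Real.smoothTransition.one_of_one_le ((one_le_div hε).2 hr)

theorem monotone_smoothCut (hε : 0 < ε) : Monotone (smoothCut ε) := fun _ _ h =>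
  Real.smoothTransition.monotone (div_le_div_of_nonneg_right h hε.le)

theorem hasDerivAt_smoothCut (r : ℝ) : HasDerivAt (smoothCut ε) (deriv (smoothCut ε) r) r :=
  ((contDiff_smoothCut (n := 1)).differentiable (by simp) r).hasDerivAt

theorem continuous_deriv_smoothCut : Continuous (deriv (smoothCut ε)) :=
  (contDiff_smoothCut (n := 1)).continuous_deriv (by simp)

theorem deriv_smoothCut_nonneg (hε : 0 < ε) (r : ℝ) : 0 ≤ deriv (smoothCut ε) r :=
  (monotone_smoothCut hε).deriv_nonneg

theorem deriv_smoothCut_eq_zero (hε : 0 < ε) {r : ℝ} (hr : r ∉ Icc 0 ε) :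
    deriv (smoothCut ε) r = 0 := by
  rw [mem_Icc, not_and_or, not_le, not_le] at hr
  rcases hr with hr | hr
  · have : smoothCut ε =ᶠ[𝓝 r] fun _ => 0 := by
      filter_upwards [Iio_mem_nhds hr] with s hs using smoothCut_of_nonpos hε (le_of_lt hs)
    rw [this.deriv_eq, deriv_const]
  · have : smoothCut ε =ᶠ[𝓝 r] fun _ => 1 := by
      filter_upwards [Ioi_mem_nhds hr] with s hs using smoothCut_of_ge hε (le_of_lt hs)
    rw [this.deriv_eq, deriv_const]

theorem hasCompactSupport_deriv_smoothCut (hε : 0 < ε) :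
    HasCompactSupport (deriv (smoothCut ε)) :=
  HasCompactSupport.intro isCompact_Icc fun _ h => deriv_smoothCut_eq_zero hε h

theorem integral_deriv_smoothCut (hε : 0 < ε) : ∫ r, deriv (smoothCut ε) r = 1 := by
  have h1 : ∫ r, deriv (smoothCut ε) r = ∫ r in (0 : ℝ)..ε, deriv (smoothCut ε) r := by
    rw [intervalIntegral.integral_of_le hε.le, ← integral_Icc_eq_integral_Ioc,
      setIntegral_eq_integral_of_forall_compl_eq_zero]
    exact fun r hr => deriv_smoothCut_eq_zero hε hr
  rw [h1, intervalIntegral.integral_deriv_eq_sub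
    (fun r _ => (hasDerivAt_smoothCut r).differentiableAt)
    (continuous_deriv_smoothCut.intervalIntegrable _ _), smoothCut_of_ge hε le_rfl,
    smoothCut_of_nonpos hε le_rfl, sub_zero]

theorem integral_deriv_smoothCut_sub_right (hε : 0 < ε) (a : ℝ) :
    ∫ r, deriv (smoothCut ε) (r - a) = 1 := by
  rw [integral_sub_right_eq_self (deriv (smoothCut ε)) a, integral_deriv_smoothCut hε]

theorem integral_deriv_smoothCut_sub_left (hε : 0 < ε) (a : ℝ) :
    ∫ r, deriv (smoothCut ε) (a - r) = 1 := by
  rw [integral_sub_left_eq_self (deriv (smoothCut ε)) volume a, integral_deriv_smoothCut hε]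

theorem integrable_deriv_smoothCut (hε : 0 < ε) : Integrable (deriv (smoothCut ε)) :=
  continuous_deriv_smoothCut.integrable_of_hasCompactSupport
    (hasCompactSupport_deriv_smoothCut hε)

/-- The derivatives of the cut-off form an approximate identity: nonnegative, of mass one, supported
in [0, ε]. -/
theorem tendsto_integral_deriv_smoothCut_mul {M : ℝ → ℝ} (hM : Continuous M) (a : ℝ) :
    Tendsto (fun ε => ∫ t, deriv (smoothCut ε) (t - a) * M t) (𝓝[>] 0) (𝓝 (M a)) := by
  rw [Metric.tendsto_nhds]
  intro η hη
  obtain ⟨δ, hδ, H⟩ := Metric.continuousAt_iff.1 (hM.continuousAt (x := a)) (η / 2) (half_pos hη)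
  filter_upwards [Ioo_mem_nhdsGT hδ] with ε hε
  have hε0 := hε.1
  have hint : Integrable fun t => deriv (smoothCut ε) (t - a) :=
    (integrable_deriv_smoothCut hε0).comp_sub_right a
  have hcs : HasCompactSupport fun t => deriv (smoothCut ε) (t - a) :=
    (hasCompactSupport_deriv_smoothCut hε0).comp_homeomorph (Homeomorph.subRight a)
  have hint2 : Integrable fun t => deriv (smoothCut ε) (t - a) * M t :=
    ((continuous_deriv_smoothCut.comp (continuous_sub_right a)).mul
      hM).integrable_of_hasCompactSupport hcs.mul_right
  have h1 : (∫ t, deriv (smoothCut ε) (t - a) * M t) - M a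
      = ∫ t, deriv (smoothCut ε) (t - a) * (M t - M a) := by
    simp_rw [mul_sub]
    rw [integral_sub hint2 (hint.mul_const _), integral_mul_const,
      integral_deriv_smoothCut_sub_right hε0, one_mul]
  rw [Real.dist_eq, h1, ← Real.norm_eq_abs]
  refine lt_of_le_of_lt (?_ : _ ≤ η / 2) (half_lt_self hη)
  refine (norm_integral_le_of_norm_le (hint.mul_const (η / 2)) ?_).trans ?_
  · filter_upwards with t
    rw [norm_mul, Real.norm_of_nonneg (deriv_smoothCut_nonneg hε0 _)]
    by_cases ht : t - a ∈ Icc 0 ε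
    · refine mul_le_mul_of_nonneg_left ?_ (deriv_smoothCut_nonneg hε0 _)
      refine (H ?_).le
      rw [Real.dist_eq, abs_lt]
      constructor <;> linarith [ht.1, ht.2, hε.2]
    · simp [deriv_smoothCut_eq_zero hε0 ht]
  · rw [integral_mul_const, integral_deriv_smoothCut_sub_right hε0, one_mul]

end smoothCut

/-! ### Difference quotients of absolutely continuous functions -/

/-- The forward difference quotient of `f` with step `h`. -/
noncomputable def fwdQuot (h : ℝ) (f : ℝ → ℝ) (x : ℝ) : ℝ := (f (x + h) - f x) / h

/-- The `L²` modulus of continuity `∫ |w (x + k) - w x|² dx` of `w`. -/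
noncomputable def translateSq (w : ℝ → ℝ) (k : ℝ) : ℝ≥0∞ := ∫⁻ x, ‖w (x + k) - w x‖ₑ ^ 2

theorem lintegral_enorm_sq_eq (f : ℝ → ℝ) (μ : Measure ℝ) :
    ∫⁻ x, ‖f x‖ₑ ^ 2 ∂μ = eLpNorm f 2 μ ^ 2 := by
  have := eLpNorm_nnreal_pow_eq_lintegral (f := f) (μ := μ) (p := 2) (by norm_num)
  simpa using this.symm

theorem enorm_sq_eq_ofReal (a : ℝ) : ‖a‖ₑ ^ 2 = ENNReal.ofReal (a ^ 2) := by
  rw [Real.enorm_eq_ofReal_abs, ← ENNReal.ofReal_pow (abs_nonneg a), sq_abs]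

theorem lintegral_enorm_sq_lt_top {f : ℝ → ℝ} {μ : Measure ℝ} (hf : MemLp f 2 μ) :
    ∫⁻ x, ‖f x‖ₑ ^ 2 ∂μ < ⊤ := by
  rw [lintegral_enorm_sq_eq]
  exact ENNReal.pow_lt_top hf.2

/-- The additive group acts continuously on L² by translations; evaluate the resulting continuous
map k ↦ ‖w(· + k) - w‖² at k = 0. -/
theorem tendsto_translateSq {w : ℝ → ℝ} (hw : MemLp w 2 volume) :
    Tendsto (translateSq w) (𝓝 0) (𝓝 0) := by
  have : Fact ((2 : ℝ≥0∞) ≠ ⊤) := ⟨by simp⟩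
  let F : Lp ℝ 2 (volume : Measure ℝ) := hw.toLp w
  have h1 : Continuous fun k : ℝ => (DomAddAct.mk k +ᵥ F) :=
    (DomAddAct.continuous_mk).vadd continuous_const
  have h2 : Tendsto (fun k : ℝ => edist (DomAddAct.mk k +ᵥ F) F ^ 2) (𝓝 0) (𝓝 0) := by
    have h3 : Continuous fun k : ℝ => edist (DomAddAct.mk k +ᵥ F) F ^ 2 :=
      ENNReal.continuous_pow 2 |>.comp (h1.edist continuous_const)
    have h4 := h3.tendsto 0
    have h5 : DomAddAct.mk (0 : ℝ) +ᵥ F = F := zero_vadd _ F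
    simpa [h5] using h4
  refine h2.congr fun k => ?_
  rw [translateSq, lintegral_enorm_sq_eq, DomAddAct.mk_vadd_toLp, Lp.edist_toLp_toLp]
  congr 2
  ext x
  simp [add_comm]

theorem translateSq_le {w : ℝ → ℝ} (hw : AEStronglyMeasurable w volume) (k : ℝ) :
    translateSq w k ≤ 4 * ∫⁻ x, ‖w x‖ₑ ^ 2 := by
  have hmp : MeasurePreserving (fun x : ℝ => x + k) volume volume :=
    measurePreserving_add_right volume k
  have h2 : eLpNorm (fun x => w (x + k)) 2 volume = eLpNorm w 2 volume :=
    eLpNorm_comp_measurePreserving hw hmp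
  rw [translateSq, lintegral_enorm_sq_eq, lintegral_enorm_sq_eq]
  have h1 : eLpNorm (fun x => w (x + k) - w x) 2 volume ≤ 2 * eLpNorm w 2 volume := by
    refine (eLpNorm_sub_le (hw.comp_measurePreserving hmp) hw (by norm_num)).trans ?_
    rw [two_mul]
    exact add_le_add h2.le le_rfl
  calc _ ≤ (2 * eLpNorm w 2 volume) ^ 2 := by gcongr
    _ = _ := by rw [mul_pow]; norm_num

section Slope

variable {f : ℝ → ℝ}

theorem ae_hasDerivAt_of_absolutelyContinuous
    (hf : ∀ a b, AbsolutelyContinuousOnInterval f a b) : ∀ᵐ x, HasDerivAt f (deriv f x) x := by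
  have h1 : ∀ n : ℕ, ∀ᵐ x, x ∈ uIcc (-(n : ℝ)) n → DifferentiableAt ℝ f x := fun n =>
    (hf _ _).ae_differentiableAt
  filter_upwards [ae_all_iff.2 h1] with x hx
  obtain ⟨n, hn⟩ := exists_nat_ge |x|
  refine (hx n ?_).hasDerivAt
  rw [uIcc_of_le (by linarith [abs_nonneg x])]
  exact abs_le.1 hn

theorem tendsto_fwdQuot {x d : ℝ} (hx : HasDerivAt f d x) :
    Tendsto (fun h => fwdQuot h f x) (𝓝[>] 0) (𝓝 d) := by
  have h1 := hx.tendsto_slope_zero_right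
  refine h1.congr fun h => ?_
  rw [fwdQuot, smul_eq_mul, div_eq_inv_mul]

theorem fwdQuot_eq_integral (hf : ∀ a b, AbsolutelyContinuousOnInterval f a b) (h x : ℝ) :
    fwdQuot h f x = h⁻¹ * ∫ k in (0 : ℝ)..h, deriv f (x + k) := by
  rw [fwdQuot, div_eq_inv_mul, intervalIntegral.integral_comp_add_left, add_zero,
    (hf _ _).integral_deriv_eq_sub]

theorem intervalIntegrable_deriv_comp_add
    (hf : ∀ a b, AbsolutelyContinuousOnInterval f a b) (h x : ℝ) :
    IntervalIntegrable (fun k => deriv f (x + k)) volume 0 h := by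
  have := (hf (x + 0) (x + h)).intervalIntegrable_deriv
  simpa using this.comp_add_left x

/-- The mean of `w²` over `[x, x + h]`. -/
noncomputable def fwdMeanSq (h : ℝ) (w : ℝ → ℝ) (x : ℝ) : ℝ :=
  h⁻¹ * ∫ k in (0 : ℝ)..h, w (x + k) ^ 2

theorem intervalIntegrable_sq_comp_add {w : ℝ → ℝ} (hw : MemLp w 2 volume) (h x : ℝ) :
    IntervalIntegrable (fun k => w (x + k) ^ 2) volume 0 h :=
  (hw.integrable_sq.comp_add_left x).intervalIntegrable

/-- Taking c to be the difference quotient gives Jensen's inequality for the mean of w²; taking c =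
w(x) gives the defect `quotDefect`. -/
theorem mean_sub_sq (hf : ∀ a b, AbsolutelyContinuousOnInterval f a b)
    (hw : MemLp (deriv f) 2 volume) {h : ℝ} (hh : 0 < h) (x c : ℝ) :
    h⁻¹ * ∫ k in (0 : ℝ)..h, (deriv f (x + k) - c) ^ 2
      = fwdMeanSq h (deriv f) x - 2 * c * fwdQuot h f x + c ^ 2 := by
  have h1 := intervalIntegrable_sq_comp_add hw h x
  have h2 := intervalIntegrable_deriv_comp_add hf h x
  have h3 : ∀ k, (deriv f (x + k) - c) ^ 2
      = deriv f (x + k) ^ 2 - 2 * c * deriv f (x + k) + c ^ 2 := fun k => by ring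
  simp_rw [h3]
  rw [intervalIntegral.integral_add (h1.sub (h2.const_mul _)) intervalIntegrable_const,
    intervalIntegral.integral_sub h1 (h2.const_mul _), intervalIntegral.integral_const_mul,
    intervalIntegral.integral_const, fwdMeanSq, fwdQuot_eq_integral hf]
  simp only [sub_zero, smul_eq_mul]
  field_simp

theorem ofReal_mean_sub_sq {w : ℝ → ℝ} (hw : MemLp w 2 volume) {h : ℝ} (hh : 0 < h) (x c : ℝ) :
    ENNReal.ofReal (h⁻¹ * ∫ k in (0 : ℝ)..h, (w (x + k) - c) ^ 2)
      = ENNReal.ofReal h⁻¹ * ∫⁻ k in Ioc 0 h, ‖w (x + k) - c‖ₑ ^ 2 := by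
  have h1 : MemLp (fun k => w (x + k)) 2 (volume.restrict (Ioc 0 h)) :=
    ((hw.comp_measurePreserving (measurePreserving_add_left volume x)).restrict _)
  have h2 : Integrable (fun k => (w (x + k) - c) ^ 2) (volume.restrict (Ioc 0 h)) :=
    (h1.sub (memLp_const c)).integrable_sq
  rw [ENNReal.ofReal_mul (inv_nonneg.2 hh.le), intervalIntegral.integral_of_le hh.le,
    ofReal_integral_eq_lintegral_ofReal h2 (Eventually.of_forall fun k => sq_nonneg _)]
  simp_rw [enorm_sq_eq_ofReal]

/-- Tonelli: an average over k of functions of x whose integrals share a bound has an integral with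
the same bound. -/
theorem lintegral_mean_le {F : ℝ → ℝ → ℝ≥0∞} (hF : Measurable (Function.uncurry F)) {h : ℝ}
    (hh : 0 < h) {S : ℝ≥0∞} (hS : ∀ k ∈ Ioc 0 h, ∫⁻ x, F x k ≤ S) :
    ∫⁻ x, ENNReal.ofReal h⁻¹ * ∫⁻ k in Ioc 0 h, F x k ≤ S := by
  have hF2 : Measurable fun x => ∫⁻ k in Ioc 0 h, F x k := hF.lintegral_prod_right'
  rw [lintegral_const_mul _ hF2,
    lintegral_lintegral_swap hF.aemeasurable]
  calc ENNReal.ofReal h⁻¹ * ∫⁻ k in Ioc 0 h, ∫⁻ x, F x k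
      ≤ ENNReal.ofReal h⁻¹ * ∫⁻ _ in Ioc 0 h, S := mul_le_mul' le_rfl (setLIntegral_mono measurable_const hS)
    _ = ENNReal.ofReal h⁻¹ * (S * ENNReal.ofReal h) := by simp
    _ = S := by
        rw [mul_comm S, ← mul_assoc, ← ENNReal.ofReal_mul (inv_nonneg.2 hh.le),
          inv_mul_cancel₀ hh.ne']
        simp

theorem lintegral_fwdMeanSq_le {w : ℝ → ℝ} (hwm : Measurable w) (hw : MemLp w 2 volume) {h : ℝ}
    (hh : 0 < h) : ∫⁻ x, ENNReal.ofReal (fwdMeanSq h w x) ≤ ∫⁻ x, ‖w x‖ₑ ^ 2 := by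
  have h1 : ∀ x, ENNReal.ofReal (fwdMeanSq h w x)
      = ENNReal.ofReal h⁻¹ * ∫⁻ k in Ioc 0 h, ‖w (x + k)‖ₑ ^ 2 := fun x => by
    simpa [fwdMeanSq] using ofReal_mean_sub_sq hw hh x 0
  simp_rw [h1]
  refine lintegral_mean_le (F := fun x k => ‖w (x + k)‖ₑ ^ 2)
    (by unfold Function.uncurry; fun_prop) hh fun k _ => ?_
  exact (lintegral_add_right_eq_self (fun x => ‖w x‖ₑ ^ 2) k).le

theorem lintegral_fwdQuot_sq_le (hf : ∀ a b, AbsolutelyContinuousOnInterval f a b)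
    (hw : MemLp (deriv f) 2 volume) {h : ℝ} (hh : 0 < h) :
    ∫⁻ x, ‖fwdQuot h f x‖ₑ ^ 2 ≤ ∫⁻ x, ‖deriv f x‖ₑ ^ 2 := by
  refine le_trans (lintegral_mono fun x => ?_) (lintegral_fwdMeanSq_le (measurable_deriv f) hw hh)
  rw [enorm_sq_eq_ofReal]
  refine ENNReal.ofReal_le_ofReal ?_
  have h1 := mean_sub_sq hf hw hh x (fwdQuot h f x)
  have h2 : 0 ≤ h⁻¹ * ∫ k in (0 : ℝ)..h, (deriv f (x + k) - fwdQuot h f x) ^ 2 :=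
    mul_nonneg (inv_nonneg.2 hh.le)
      (intervalIntegral.integral_nonneg hh.le fun k _ => sq_nonneg _)
  nlinarith

/-- The defect `½ mean(w²) - w wₕ + ½ w²`, which is half the mean of `(w (x + k) - w x)²`. -/
noncomputable def quotDefect (h : ℝ) (f : ℝ → ℝ) (x : ℝ) : ℝ :=
  fwdMeanSq h (deriv f) x / 2 - deriv f x * fwdQuot h f x + deriv f x ^ 2 / 2

theorem quotDefect_eq (hf : ∀ a b, AbsolutelyContinuousOnInterval f a b)
    (hw : MemLp (deriv f) 2 volume) {h : ℝ} (hh : 0 < h) (x : ℝ) :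
    quotDefect h f x = (h⁻¹ * ∫ k in (0 : ℝ)..h, (deriv f (x + k) - deriv f x) ^ 2) / 2 := by
  rw [mean_sub_sq hf hw hh, quotDefect]; ring

/-- The decisive commutator estimate. The mean of w² and the product w w_h combine, after adding
w²/2, into a mean of squared increments, so the L² modulus of continuity suffices. -/
theorem lintegral_quotDefect_le (hf : ∀ a b, AbsolutelyContinuousOnInterval f a b)
    (hw : MemLp (deriv f) 2 volume) {h : ℝ} (hh : 0 < h) {S : ℝ≥0∞}
    (hS : ∀ k ∈ Ioc 0 h, translateSq (deriv f) k ≤ S) :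
    ∫⁻ x, ‖quotDefect h f x‖ₑ ≤ S := by
  have hm : Measurable (deriv f) := measurable_deriv f
  refine le_trans (lintegral_mono fun x => ?_)
    (lintegral_mean_le (F := fun x k => ‖deriv f (x + k) - deriv f x‖ₑ ^ 2)
      (by unfold Function.uncurry; fun_prop) hh hS)
  dsimp only
  rw [← ofReal_mean_sub_sq hw hh, quotDefect_eq hf hw hh]
  have h2 : 0 ≤ h⁻¹ * ∫ k in (0 : ℝ)..h, (deriv f (x + k) - deriv f x) ^ 2 :=
    mul_nonneg (inv_nonneg.2 hh.le)
      (intervalIntegral.integral_nonneg hh.le fun k _ => sq_nonneg _)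
  rw [Real.enorm_eq_ofReal (by positivity)]
  exact ENNReal.ofReal_le_ofReal (by linarith)

end Slope

/-! ### Vanishing of the renormalization residual at a fixed time -/

/-- The residual of the renormalized equation for difference quotients, where `β`, `βw`, `βs`
stand for a renormalization function and its two partial derivatives at a fixed time. -/
noncomputable def renormResidual (β βw βs : ℝ → ℝ) (h : ℝ) (f : ℝ → ℝ) (x : ℝ) : ℝ :=
  βs (fwdQuot h f x)
    + βw (fwdQuot h f x) * (fwdMeanSq h (deriv f) x / 2 - deriv f x * fwdQuot h f x)
    + β (fwdQuot h f x) * deriv f (x + h)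

/-- The part of the residual which does not involve translates. -/
noncomputable def renormMain (β βw βs : ℝ → ℝ) (h : ℝ) (f : ℝ → ℝ) (x : ℝ) : ℝ :=
  βs (fwdQuot h f x) - βw (fwdQuot h f x) * (deriv f x ^ 2 / 2) + β (fwdQuot h f x) * deriv f x

/-- The supremum of the `L²` modulus of continuity over translations in `(0, h]`. -/
noncomputable def supTranslateSq (w : ℝ → ℝ) (h : ℝ) : ℝ≥0∞ := ⨆ k ∈ Ioc 0 h, translateSq w k

theorem tendsto_supTranslateSq {w : ℝ → ℝ} (hw : MemLp w 2 volume) :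
    Tendsto (supTranslateSq w) (𝓝[>] 0) (𝓝 0) := by
  rw [ENNReal.tendsto_nhds_zero]
  intro ε hε
  have h1 := ENNReal.tendsto_nhds_zero.1 (tendsto_translateSq hw) ε hε
  obtain ⟨δ, hδ, H⟩ := Metric.eventually_nhds_iff.1 h1
  filter_upwards [Ioo_mem_nhdsGT hδ] with h hh
  refine iSup₂_le fun k hk => H ?_
  rw [Real.dist_eq, sub_zero, abs_of_pos hk.1]
  exact hk.2.trans_lt hh.2

theorem supTranslateSq_le {w : ℝ → ℝ} (hw : AEStronglyMeasurable w volume) (h : ℝ) :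
    supTranslateSq w h ≤ 4 * ∫⁻ x, ‖w x‖ₑ ^ 2 :=
  iSup₂_le fun k _ => translateSq_le hw k

/-- Cauchy–Schwarz on a bounded interval. -/
theorem setLIntegral_enorm_translate_sub_le {w : ℝ → ℝ} (hw : Measurable w) (R h : ℝ) :
    ∫⁻ x in Icc (-R) R, ‖w (x + h) - w x‖ₑ
      ≤ translateSq w h ^ (1 / 2 : ℝ) * volume (Icc (-R) R) ^ (1 / 2 : ℝ) := by
  have hm : Measurable fun x => w (x + h) - w x := by fun_prop
  have h1 := eLpNorm_le_eLpNorm_mul_rpow_measure_univ (p := 1) (q := 2)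
    (μ := volume.restrict (Icc (-R) R)) (f := fun x => w (x + h) - w x) (by norm_num)
    hm.aestronglyMeasurable
  rw [eLpNorm_one_eq_lintegral_enorm, Measure.restrict_apply_univ] at h1
  refine h1.trans ?_
  have h2 : eLpNorm (fun x => w (x + h) - w x) 2 (volume.restrict (Icc (-R) R))
      ≤ translateSq w h ^ (1 / 2 : ℝ) := by
    refine (eLpNorm_mono_measure _ Measure.restrict_le_self).trans ?_
    rw [translateSq, lintegral_enorm_sq_eq, ← ENNReal.rpow_natCast, ← ENNReal.rpow_mul]
    norm_num
  refine mul_le_mul' h2 (le_of_eq ?_)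
  norm_num

section Residual

variable {f β βw βs : ℝ → ℝ} {C : ℝ}

/-- The split isolates a main part with an integrable majorant independent of h, to which dominated
convergence applies. The two remaining terms involve translates and are controlled by the L² modulus
of continuity. -/
theorem renormResidual_eq (h x : ℝ) :
    renormResidual β βw βs h f x = renormMain β βw βs h f x
      + βw (fwdQuot h f x) * quotDefect h f x
      + β (fwdQuot h f x) * (deriv f (x + h) - deriv f x) := by
  rw [renormResidual, renormMain, quotDefect]; ring

theorem measurable_fwdQuot (hf : Continuous f) (h : ℝ) : Measurable (fwdQuot h f) := by
  unfold fwdQuot; fun_prop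

theorem measurable_renormMain (hf : Continuous f) (hβ : Continuous β) (hβw : Continuous βw)
    (hβs : Continuous βs) (h : ℝ) : Measurable (renormMain β βw βs h f) := by
  have h1 := measurable_fwdQuot hf h
  have h2 := measurable_deriv f
  have := hβ.measurable.comp h1
  have := hβw.measurable.comp h1
  have := hβs.measurable.comp h1
  unfold renormMain
  simp only [Function.comp_def] at *
  fun_prop

theorem lintegral_renormResidual_le (hfc : Continuous f)
    (hf : ∀ a b, AbsolutelyContinuousOnInterval f a b)
    (hw : MemLp (deriv f) 2 volume) (hβ : Continuous β) (hβw : Continuous βw)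
    (hβs : Continuous βs) (hβC : ∀ v, |β v| ≤ C) (hβwC : ∀ v, |βw v| ≤ C) {h : ℝ} (hh : 0 < h)
    (R : ℝ) :
    ∫⁻ x in Icc (-R) R, ‖renormResidual β βw βs h f x‖ₑ
      ≤ (∫⁻ x in Icc (-R) R, ‖renormMain β βw βs h f x‖ₑ)
        + ENNReal.ofReal C * (supTranslateSq (deriv f) h
          + supTranslateSq (deriv f) h ^ (1 / 2 : ℝ) * volume (Icc (-R) R) ^ (1 / 2 : ℝ)) := by
  have hdm : Measurable (deriv f) := measurable_deriv f
  have hC : ∀ a b : ℝ, |a| ≤ C → ‖a * b‖ₑ ≤ ENNReal.ofReal C * ‖b‖ₑ := fun a b hab => by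
    rw [enorm_mul, Real.enorm_eq_ofReal_abs a]
    gcongr
  have hS : ∀ k ∈ Ioc 0 h, translateSq (deriv f) k ≤ supTranslateSq (deriv f) h := fun k hk =>
    le_iSup₂ (f := fun k (_ : k ∈ Ioc 0 h) => translateSq (deriv f) k) k hk
  calc ∫⁻ x in Icc (-R) R, ‖renormResidual β βw βs h f x‖ₑ
      ≤ ∫⁻ x in Icc (-R) R, (‖renormMain β βw βs h f x‖ₑ
          + (ENNReal.ofReal C * ‖quotDefect h f x‖ₑ
            + ENNReal.ofReal C * ‖deriv f (x + h) - deriv f x‖ₑ)) := by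
        refine lintegral_mono fun x => ?_
        rw [renormResidual_eq, add_assoc]
        refine (enorm_add_le _ _).trans (add_le_add le_rfl ?_)
        exact (enorm_add_le _ _).trans (add_le_add (hC _ _ (hβwC _)) (hC _ _ (hβC _)))
    _ = (∫⁻ x in Icc (-R) R, ‖renormMain β βw βs h f x‖ₑ)
          + (ENNReal.ofReal C * (∫⁻ x in Icc (-R) R, ‖quotDefect h f x‖ₑ)
            + ENNReal.ofReal C * ∫⁻ x in Icc (-R) R, ‖deriv f (x + h) - deriv f x‖ₑ) := by
        rw [lintegral_add_left (measurable_renormMain hfc hβ hβw hβs h).enorm,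
          lintegral_add_right _ (by fun_prop),
          lintegral_const_mul' _ _ ENNReal.ofReal_ne_top,
          lintegral_const_mul' _ _ ENNReal.ofReal_ne_top]
    _ ≤ _ := by
        rw [← mul_add]
        refine add_le_add le_rfl (mul_le_mul' le_rfl (add_le_add ?_ ?_))
        · exact (setLIntegral_le_lintegral _ _).trans (lintegral_quotDefect_le hf hw hh hS)
        · refine (setLIntegral_enorm_translate_sub_le hdm R h).trans ?_
          gcongr
          exact hS h ⟨hh, le_rfl⟩

theorem abs_renormMain_le (hβC : ∀ v, |β v| ≤ C) (hβwC : ∀ v, |βw v| ≤ C)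
    (hβsC : ∀ v, |βs v| ≤ C) (h x : ℝ) :
    |renormMain β βw βs h f x| ≤ 2 * C * (1 + deriv f x ^ 2) := by
  have h1 := hβC (fwdQuot h f x)
  have h2 := hβwC (fwdQuot h f x)
  have h3 := hβsC (fwdQuot h f x)
  have hC : 0 ≤ C := (abs_nonneg _).trans h1
  rw [renormMain]
  have e1 : |βw (fwdQuot h f x) * (deriv f x ^ 2 / 2)| ≤ C * (deriv f x ^ 2 / 2) := by
    rw [abs_mul, abs_of_nonneg (by positivity : (0 : ℝ) ≤ deriv f x ^ 2 / 2)]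
    gcongr
  have e2 : |β (fwdQuot h f x) * deriv f x| ≤ C * ((1 + deriv f x ^ 2) / 2) := by
    rw [abs_mul]
    gcongr
    nlinarith [sq_nonneg (|deriv f x| - 1), sq_abs (deriv f x)]
  have e3 := abs_add_le (βs (fwdQuot h f x) - βw (fwdQuot h f x) * (deriv f x ^ 2 / 2))
    (β (fwdQuot h f x) * deriv f x)
  have e4 := abs_sub (βs (fwdQuot h f x)) (βw (fwdQuot h f x) * (deriv f x ^ 2 / 2))
  nlinarith [mul_nonneg hC (sq_nonneg (deriv f x))]

theorem enorm_renormMain_le (hβC : ∀ v, |β v| ≤ C) (hβwC : ∀ v, |βw v| ≤ C)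
    (hβsC : ∀ v, |βs v| ≤ C) (h x : ℝ) :
    ‖renormMain β βw βs h f x‖ₑ ≤ ENNReal.ofReal (2 * C) * (1 + ‖deriv f x‖ₑ ^ 2) := by
  have hC : 0 ≤ C := (abs_nonneg _).trans (hβC 0)
  rw [enorm_sq_eq_ofReal, Real.enorm_eq_ofReal_abs, ← ENNReal.ofReal_one,
    ← ENNReal.ofReal_add zero_le_one (sq_nonneg _), ← ENNReal.ofReal_mul (by positivity)]
  exact ENNReal.ofReal_le_ofReal (abs_renormMain_le hβC hβwC hβsC h x)

theorem setLIntegral_one_add_sq (R : ℝ) :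
    ∫⁻ x in Icc (-R) R, ENNReal.ofReal (2 * C) * (1 + ‖deriv f x‖ₑ ^ 2)
      ≤ ENNReal.ofReal (2 * C) * (volume (Icc (-R) R) + ∫⁻ x, ‖deriv f x‖ₑ ^ 2) := by
  have hdm : Measurable (deriv f) := measurable_deriv f
  rw [lintegral_const_mul' _ _ ENNReal.ofReal_ne_top, lintegral_add_left measurable_const]
  refine mul_le_mul' le_rfl (add_le_add (by simp) (setLIntegral_le_lintegral _ _))

/-- A bound for the residual depending only on the size of the data. -/
noncomputable def residualBound (C R : ℝ) (Q : ℝ≥0∞) : ℝ≥0∞ :=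
  ENNReal.ofReal (2 * C) * (volume (Icc (-R) R) + Q)
    + ENNReal.ofReal C * (4 * Q + (4 * Q) ^ (1 / 2 : ℝ) * volume (Icc (-R) R) ^ (1 / 2 : ℝ))

theorem residualBound_lt_top {C R : ℝ} {Q : ℝ≥0∞} (hQ : Q < ⊤) : residualBound C R Q < ⊤ := by
  unfold residualBound
  have h1 : volume (Icc (-R) R) < ⊤ := measure_Icc_lt_top
  have h2 : 4 * Q < ⊤ := ENNReal.mul_lt_top (by simp) hQ
  refine ENNReal.add_lt_top.2 ⟨ENNReal.mul_lt_top ENNReal.ofReal_lt_top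
    (ENNReal.add_lt_top.2 ⟨h1, hQ⟩), ENNReal.mul_lt_top ENNReal.ofReal_lt_top
    (ENNReal.add_lt_top.2 ⟨h2, ENNReal.mul_lt_top ?_ ?_⟩)⟩
  · exact ENNReal.rpow_lt_top_of_nonneg (by norm_num) h2.ne
  · exact ENNReal.rpow_lt_top_of_nonneg (by norm_num) h1.ne

/-- The bound is independent of h and, when the energy is uniformly bounded, of time; it is the
majorant for the later limit under the time integral. -/
theorem lintegral_renormResidual_le_bound (hfc : Continuous f)
    (hf : ∀ a b, AbsolutelyContinuousOnInterval f a b)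
    (hw : MemLp (deriv f) 2 volume) (hβ : Continuous β) (hβw : Continuous βw)
    (hβs : Continuous βs) (hβC : ∀ v, |β v| ≤ C) (hβwC : ∀ v, |βw v| ≤ C)
    (hβsC : ∀ v, |βs v| ≤ C) {h : ℝ} (hh : 0 < h) (R : ℝ) {Q : ℝ≥0∞}
    (hQ : ∫⁻ x, ‖deriv f x‖ₑ ^ 2 ≤ Q) :
    ∫⁻ x in Icc (-R) R, ‖renormResidual β βw βs h f x‖ₑ ≤ residualBound C R Q := by
  refine (lintegral_renormResidual_le hfc hf hw hβ hβw hβs hβC hβwC hh R).trans ?_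
  have h1 : supTranslateSq (deriv f) h ≤ 4 * Q :=
    (supTranslateSq_le hw.1 h).trans (mul_le_mul' le_rfl hQ)
  unfold residualBound
  refine add_le_add ?_ ?_
  · refine (lintegral_mono fun x => enorm_renormMain_le hβC hβwC hβsC h x).trans
      ((setLIntegral_one_add_sq R).trans ?_)
    gcongr
  · gcongr

/-- The quotient tends to w(x) almost everywhere, and `hbal`, the transport equation for the
renormalization function, makes the limit of the main part zero. -/
theorem tendsto_lintegral_renormResidual (hfc : Continuous f)
    (hf : ∀ a b, AbsolutelyContinuousOnInterval f a b)
    (hw : MemLp (deriv f) 2 volume) (hβ : Continuous β) (hβw : Continuous βw)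
    (hβs : Continuous βs) (hβC : ∀ v, |β v| ≤ C) (hβwC : ∀ v, |βw v| ≤ C)
    (hβsC : ∀ v, |βs v| ≤ C) (hbal : ∀ v, βs v - βw v * (v ^ 2 / 2) + β v * v = 0)
    {h : ℕ → ℝ} (hh : ∀ n, 0 < h n) (hlim : Tendsto h atTop (𝓝 0)) (R : ℝ) :
    Tendsto (fun n => ∫⁻ x in Icc (-R) R, ‖renormResidual β βw βs (h n) f x‖ₑ) atTop (𝓝 0) := by
  have hlim' : Tendsto h atTop (𝓝[>] 0) :=
    tendsto_nhdsWithin_iff.2 ⟨hlim, Eventually.of_forall hh⟩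
  have h1 : Tendsto (fun n => ∫⁻ x in Icc (-R) R, ‖renormMain β βw βs (h n) f x‖ₑ) atTop
      (𝓝 (∫⁻ _ in Icc (-R) R, 0)) := by
    refine tendsto_lintegral_of_dominated_convergence
      (fun x => ENNReal.ofReal (2 * C) * (1 + ‖deriv f x‖ₑ ^ 2))
      (fun n => (measurable_renormMain hfc hβ hβw hβs (h n)).enorm)
      (fun n => Eventually.of_forall fun x => enorm_renormMain_le hβC hβwC hβsC (h n) x) ?_ ?_
    · refine ((setLIntegral_one_add_sq R).trans_lt ?_).ne
      exact ENNReal.mul_lt_top ENNReal.ofReal_lt_top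
        (ENNReal.add_lt_top.2 ⟨measure_Icc_lt_top, lintegral_enorm_sq_lt_top hw⟩)
    · refine ae_restrict_of_ae ?_
      filter_upwards [ae_hasDerivAt_of_absolutelyContinuous hf] with x hx
      have hq : Tendsto (fun n => fwdQuot (h n) f x) atTop (𝓝 (deriv f x)) :=
        (tendsto_fwdQuot hx).comp hlim'
      have h2 : Tendsto (fun n => renormMain β βw βs (h n) f x) atTop (𝓝 0) := by
        rw [← hbal (deriv f x)]
        exact (((hβs.tendsto _).comp hq).sub (((hβw.tendsto _).comp hq).mul_const _)).add
          (((hβ.tendsto _).comp hq).mul_const _)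
      simpa using h2.enorm
  have h2 : Tendsto (fun n => supTranslateSq (deriv f) (h n)) atTop (𝓝 0) :=
    (tendsto_supTranslateSq hw).comp hlim'
  have h3 : Tendsto (fun n => ENNReal.ofReal C * (supTranslateSq (deriv f) (h n)
      + supTranslateSq (deriv f) (h n) ^ (1 / 2 : ℝ) * volume (Icc (-R) R) ^ (1 / 2 : ℝ))) atTop
      (𝓝 (ENNReal.ofReal C * (0 + 0 ^ (1 / 2 : ℝ) * volume (Icc (-R) R) ^ (1 / 2 : ℝ)))) := by
    refine ENNReal.Tendsto.const_mul (h2.add (ENNReal.Tendsto.mul_const (h2.ennrpow_const _) ?_))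
      (Or.inr ENNReal.ofReal_ne_top)
    exact Or.inr (ENNReal.rpow_lt_top_of_nonneg (by norm_num) measure_Icc_lt_top.ne).ne
  have h4 := h1.add h3
  simp only [lintegral_zero, zero_add] at h4
  rw [ENNReal.zero_rpow_of_pos (by norm_num), zero_mul, mul_zero] at h4
  exact tendsto_of_tendsto_of_tendsto_of_le_of_le tendsto_const_nhds h4 (fun n => zero_le)
    fun n => lintegral_renormResidual_le hfc hf hw hβ hβw hβs hβC hβwC (hh n) R

end Residual

/-! ### The renormalization functions -/

/-- The square of the positive part. -/
noncomputable def sqPos (x : ℝ) : ℝ := max x 0 ^ 2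

theorem hasDerivAt_sqPos (x : ℝ) : HasDerivAt sqPos (2 * max x 0) x := by
  rcases lt_trichotomy x 0 with hx | hx | hx
  · have h : sqPos =ᶠ[𝓝 x] fun _ => 0 := by
      filter_upwards [Iio_mem_nhds hx] with y hy
      simp [sqPos, max_eq_right (le_of_lt (mem_Iio.1 hy))]
    rw [max_eq_right hx.le, mul_zero]
    exact (hasDerivAt_const x (0 : ℝ)).congr_of_eventuallyEq h
  · subst hx
    rw [max_self, mul_zero, hasDerivAt_iff_isLittleO_nhds_zero]
    have h : (fun y : ℝ => sqPos (0 + y) - sqPos 0 - y • (0 : ℝ)) =O[𝓝 0] fun y => y ^ 2 := by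
      refine Asymptotics.IsBigO.of_bound 1 (Eventually.of_forall fun y => ?_)
      have h : sqPos (0 + y) - sqPos 0 - y • (0 : ℝ) = max y 0 ^ 2 := by simp [sqPos]
      rw [h, norm_pow, norm_pow, one_mul]
      gcongr
      rcases le_total y 0 with hy | hy
      · simp [max_eq_right hy]
      · simp [max_eq_left hy]
    refine h.trans_isLittleO ?_
    exact Asymptotics.isLittleO_pow_id (by norm_num)
  · have h : sqPos =ᶠ[𝓝 x] fun y => y ^ 2 := by
      filter_upwards [Ioi_mem_nhds hx] with y hy
      simp [sqPos, max_eq_left (le_of_lt (mem_Ioi.1 hy))]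
    rw [max_eq_left hx.le]
    simpa using (hasDerivAt_pow 2 x).congr_of_eventuallyEq h

theorem contDiff_sqPos : ContDiff ℝ 1 sqPos := by
  rw [contDiff_one_iff_deriv]
  refine ⟨fun x => (hasDerivAt_sqPos x).differentiableAt, ?_⟩
  have : deriv sqPos = fun x => 2 * max x 0 := funext fun x => (hasDerivAt_sqPos x).deriv
  rw [this]
  fun_prop

theorem sqPos_nonneg (x : ℝ) : 0 ≤ sqPos x := sq_nonneg _

theorem sqPos_of_nonpos {x : ℝ} (hx : x ≤ 0) : sqPos x = 0 := by simp [sqPos, hx]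

theorem sqPos_of_nonneg {x : ℝ} (hx : 0 ≤ x) : sqPos x = x ^ 2 := by simp [sqPos, hx]

/-- The lower linear form: it is positive at time `s` on the values whose initial value under
`w' = -w² / 2` exceeds `-m`. -/
noncomputable def lowerForm (m : ℝ) (p : ℝ × ℝ) : ℝ := p.1 * (1 - m * p.2 / 2) + m

/-- A regularized `w²`, conserved by the flow of `w' = -w² / 2` up to the factor coming from the
compression, and vanishing unless the initial value lies in `(-m, N)`. -/
noncomputable def renormFn (m N c : ℝ) (p : ℝ × ℝ) : ℝ :=
  p.1 ^ 2 * (c * sqPos (lowerForm m p) / (p.1 ^ 2 + c * sqPos (lowerForm m p)))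
    * (c * sqPos (-lowerForm (-N) p) / (p.1 ^ 2 + c * sqPos (-lowerForm (-N) p)))

section renormFn

variable {m N c : ℝ}

/-- Both summands are nonnegative and cannot vanish together, because the linear forms in use equal
m or N at v = 0. -/
theorem renorm_denom_pos (hc : 0 < c) {v d : ℝ} (h : v = 0 → 0 < d) :
    0 < v ^ 2 + c * sqPos d := by
  by_cases hv : v = 0
  · have hd := h hv
    rw [hv, sqPos_of_nonneg hd.le]
    positivity
  · have := sqPos_nonneg d
    positivity

theorem lowerForm_denom_pos (hm : 0 < m) (hc : 0 < c) (p : ℝ × ℝ) :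
    0 < p.1 ^ 2 + c * sqPos (lowerForm m p) :=
  renorm_denom_pos hc fun h => by simp [lowerForm, h, hm]

theorem upperForm_denom_pos (hN : 0 < N) (hc : 0 < c) (p : ℝ × ℝ) :
    0 < p.1 ^ 2 + c * sqPos (-lowerForm (-N) p) :=
  renorm_denom_pos hc fun h => by simp [lowerForm, h, hN]

theorem contDiff_lowerForm {n : ℕ∞} : ContDiff ℝ n (lowerForm m) := by
  unfold lowerForm; fun_prop

theorem contDiff_renormFn (hm : 0 < m) (hN : 0 < N) (hc : 0 < c) :
    ContDiff ℝ 1 (renormFn m N c) := by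
  have h1 : ContDiff ℝ 1 fun p => c * sqPos (lowerForm m p) :=
    contDiff_const.mul (contDiff_sqPos.comp contDiff_lowerForm)
  have h2 : ContDiff ℝ 1 fun p => c * sqPos (-lowerForm (-N) p) :=
    contDiff_const.mul (contDiff_sqPos.comp contDiff_lowerForm.neg)
  have h3 : ContDiff ℝ 1 fun p : ℝ × ℝ => p.1 ^ 2 := contDiff_fst.pow 2
  exact (h3.mul (h1.div (h3.add h1) fun p => (lowerForm_denom_pos hm hc p).ne')).mul
    (h2.div (h3.add h2) fun p => (upperForm_denom_pos hN hc p).ne')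

theorem ratio_mem_Icc {Y X : ℝ} (hX : 0 ≤ X) (hY : 0 ≤ Y) : X / (Y + X) ∈ Icc (0 : ℝ) 1 :=
  ⟨by positivity, div_le_one_of_le₀ (by linarith) (by positivity)⟩

theorem renormFn_nonneg (hc : 0 < c) (p : ℝ × ℝ) : 0 ≤ renormFn m N c p := by
  have := sqPos_nonneg (lowerForm m p)
  have := sqPos_nonneg (-lowerForm (-N) p)
  unfold renormFn
  positivity

theorem renormFn_le_sq (hc : 0 < c) (p : ℝ × ℝ) : renormFn m N c p ≤ p.1 ^ 2 := by
  have h1 := ratio_mem_Icc (mul_nonneg hc.le (sqPos_nonneg (lowerForm m p))) (sq_nonneg p.1)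
  have h2 := ratio_mem_Icc (mul_nonneg hc.le (sqPos_nonneg (-lowerForm (-N) p))) (sq_nonneg p.1)
  unfold renormFn
  rw [mul_assoc]
  exact mul_le_of_le_one_right (sq_nonneg _) (mul_le_one₀ h1.2 h2.1 h2.2)

/-- Two quantities decaying at the same logarithmic rate have a stationary quotient. -/
theorem hasDerivAt_ratio {X Y : ℝ → ℝ} {r v : ℝ} (hX : HasDerivAt X (-v * X r) r)
    (hY : HasDerivAt Y (-v * Y r) r) (h : Y r + X r ≠ 0) :
    HasDerivAt (fun r => X r / (Y r + X r)) 0 r := by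
  have h2 : -v * X r * (Y r + X r) - X r * (-v * Y r + -v * X r) = 0 := by ring
  refine (hX.div (hY.add hX) h).congr_deriv ?_
  rw [Pi.add_apply, h2, zero_div]

/-- Under v' = -v²/2 the form L = v(1 - ms/2) + m satisfies L' = -(v/2) L, so the square of its
positive part decays at rate v. The sign σ covers the lower and the upper form at once. The flow is
replaced by its tangent line at r = 0. -/
theorem hasDerivAt_sqPos_lowerForm (σ m v s : ℝ) :
    HasDerivAt (fun r => c * sqPos (σ * lowerForm m (v + r * (-v ^ 2 / 2), s + r * 1)))
      (-v * (c * sqPos (σ * lowerForm m (v + 0 * (-v ^ 2 / 2), s + 0 * 1)))) 0 := by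
  have h1 : HasDerivAt (fun r : ℝ => σ * lowerForm m (v + r * (-v ^ 2 / 2), s + r * 1))
      (σ * (-(v / 2) * lowerForm m (v, s))) 0 := by
    have e1 : HasDerivAt (fun r : ℝ => v + r * (-v ^ 2 / 2)) (-v ^ 2 / 2) 0 := by
      simpa using ((hasDerivAt_id (0 : ℝ)).mul_const (-v ^ 2 / 2)).const_add v
    have e2 : HasDerivAt (fun r : ℝ => 1 - m * (s + r * 1) / 2) (-(m / 2)) 0 := by
      have := ((((hasDerivAt_id (0 : ℝ)).mul_const 1).const_add s).const_mul m).div_const 2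
      simpa using this.const_sub 1
    refine (((e1.mul e2).add_const m).const_mul σ).congr_deriv ?_
    simp only [lowerForm]
    ring
  have h2 := ((hasDerivAt_sqPos _).comp (0 : ℝ) h1).const_mul c
  refine h2.congr_deriv ?_
  simp only [sqPos, zero_mul, add_zero]
  rcases le_total (σ * lowerForm m (v, s)) 0 with h | h
  · simp [max_eq_right h]
  · rw [max_eq_left h]; ring

/-- The factor v² and both squared positive parts decay at the same rate v. The two quotients in
`renormFn` are therefore constant along the flow, and the product inherits the rate of v². -/
theorem fderiv_renormFn (hm : 0 < m) (hN : 0 < N) (hc : 0 < c) (v s : ℝ) :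
    fderiv ℝ (renormFn m N c) (v, s) (-v ^ 2 / 2, 1) = -v * renormFn m N c (v, s) := by
  have hd : DifferentiableAt ℝ (renormFn m N c) (v, s) :=
    (contDiff_renormFn hm hN hc).differentiable (by simp) _
  rw [← hd.lineDeriv_eq_fderiv]
  refine HasDerivAt.deriv ?_
  have hY : HasDerivAt (fun r : ℝ => (v + r * (-v ^ 2 / 2)) ^ 2)
      (-v * (v + 0 * (-v ^ 2 / 2)) ^ 2) 0 := by
    have e1 : HasDerivAt (fun r : ℝ => v + r * (-v ^ 2 / 2)) (-v ^ 2 / 2) 0 := by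
      simpa using ((hasDerivAt_id (0 : ℝ)).mul_const (-v ^ 2 / 2)).const_add v
    refine (e1.pow 2).congr_deriv ?_
    norm_num
    ring
  have hX1 := hasDerivAt_sqPos_lowerForm (c := c) 1 m v s
  have hX2 := hasDerivAt_sqPos_lowerForm (c := c) (-1) (-N) v s
  simp only [one_mul, neg_one_mul] at hX1 hX2
  have h1 := hasDerivAt_ratio hX1 hY (by simpa using (lowerForm_denom_pos hm hc (v, s)).ne')
  have h2 := hasDerivAt_ratio hX2 hY
    (by simpa using (upperForm_denom_pos hN hc (v, s)).ne')
  have h3 := (hY.mul h1).mul h2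
  have h4 : (fun r : ℝ => renormFn m N c ((v, s) + r • ((-v ^ 2 / 2, 1) : ℝ × ℝ))) =
      fun r : ℝ => renormFn m N c (v + r * (-v ^ 2 / 2), s + r * 1) := by
    ext r; simp
  rw [h4]
  refine h3.congr_deriv ?_
  simp only [Pi.mul_apply, renormFn, zero_mul, add_zero, mul_zero]
  ring

theorem renormFn_eq_zero_of_ge (hN : 0 < N) {v s : ℝ} (hs : 0 ≤ s) (hv : N ≤ v) :
    renormFn m N c (v, s) = 0 := by
  have h : -lowerForm (-N) (v, s) ≤ 0 := by
    have : 0 ≤ v * (N * s / 2) := by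
      have : 0 ≤ v := hN.le.trans hv
      positivity
    simp only [lowerForm]
    linarith
  simp [renormFn, sqPos_of_nonpos h]

/-- The threshold is the value at time τ of the Riccati solution starting from -m; the condition mτ
< 2 puts τ before its blow-up. For v ≤ 0 the form at time s ≤ τ is at most the form at time τ. -/
theorem renormFn_eq_zero_of_le (hm : 0 < m) {τ v s : ℝ} (hτ : m * τ < 2) (hs : s ≤ τ)
    (hv : v ≤ -(m / (1 - m * τ / 2))) : renormFn m N c (v, s) = 0 := by
  have hq : 0 < 1 - m * τ / 2 := by linarith
  have hv0 : v ≤ 0 := hv.trans (neg_nonpos.2 (by positivity))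
  have h : lowerForm m (v, s) ≤ 0 := by
    have h1 : v * (1 - m * s / 2) ≤ v * (1 - m * τ / 2) := by
      refine mul_le_mul_of_nonpos_left ?_ hv0
      nlinarith
    have h2 : v * (1 - m * τ / 2) ≤ -m := by
      rw [← neg_div, le_div_iff₀ hq] at hv
      exact hv
    simp only [lowerForm]
    linarith
  simp [renormFn, sqPos_of_nonpos h]

/-- On [0, τ] the function vanishes outside a fixed compact range of v, and on a compact rectangle a
C¹ function and its derivatives are bounded. -/
theorem exists_bound_renormFn (hm : 0 < m) (hN : 0 < N) (hc : 0 < c) {τ : ℝ} (hτ : m * τ < 2) :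
    ∃ C, (∀ v, ∀ s ∈ Icc 0 τ, |renormFn m N c (v, s)| ≤ C) ∧
      ∀ v, ∀ s ∈ Ioo 0 τ, |fderiv ℝ (renormFn m N c) (v, s) (1, 0)| ≤ C ∧
        |fderiv ℝ (renormFn m N c) (v, s) (0, 1)| ≤ C := by
  have hb := contDiff_renormFn hm hN hc
  have hbf : Continuous (fderiv ℝ (renormFn m N c)) := hb.continuous_fderiv (by simp)
  set K : Set (ℝ × ℝ) := Icc (-(m / (1 - m * τ / 2))) N ×ˢ Icc 0 τ with hK
  have hKc : IsCompact K := isCompact_Icc.prod isCompact_Icc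
  obtain ⟨C₁, h₁⟩ := hKc.exists_bound_of_continuousOn hb.continuous.continuousOn
  obtain ⟨C₂, h₂⟩ := hKc.exists_bound_of_continuousOn
    (f := fun p => fderiv ℝ (renormFn m N c) p (1, 0)) (by fun_prop)
  obtain ⟨C₃, h₃⟩ := hKc.exists_bound_of_continuousOn
    (f := fun p => fderiv ℝ (renormFn m N c) p (0, 1)) (by fun_prop)
  have hout : ∀ v s, s ∈ Icc 0 τ → v ∉ Icc (-(m / (1 - m * τ / 2))) N →
      renormFn m N c (v, s) = 0 := fun v s hs hv => by
    rw [mem_Icc, not_and_or, not_le, not_le] at hv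
    rcases hv with hv | hv
    · exact renormFn_eq_zero_of_le hm hτ hs.2 hv.le
    · exact renormFn_eq_zero_of_ge hN hs.1 hv.le
  -- Vanishing is known only for s in [0, τ], so a whole neighbourhood of zeros is available only at
  -- interior times.
  have hout' : ∀ v s, s ∈ Ioo 0 τ → v ∉ Icc (-(m / (1 - m * τ / 2))) N →
      fderiv ℝ (renormFn m N c) (v, s) = 0 := fun v s hs hv => by
    have : renormFn m N c =ᶠ[𝓝 (v, s)] fun _ => 0 := by
      filter_upwards [prod_mem_nhds (isClosed_Icc.isOpen_compl.mem_nhds hv)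
        (isOpen_Ioo.mem_nhds hs)] with p hp
      exact hout p.1 p.2 (Ioo_subset_Icc_self hp.2) hp.1
    rw [this.fderiv_eq]
    simp
  refine ⟨max |C₁| (max |C₂| |C₃|), fun v s hs => ?_, fun v s hs => ?_⟩
  · by_cases hv : v ∈ Icc (-(m / (1 - m * τ / 2))) N
    · exact ((h₁ (v, s) ⟨hv, hs⟩).trans (le_abs_self _)).trans (le_max_left _ _)
    · rw [hout v s hs hv, abs_zero]; positivity
  · by_cases hv : v ∈ Icc (-(m / (1 - m * τ / 2))) N
    · have hs' := Ioo_subset_Icc_self hs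
      exact ⟨((h₂ (v, s) ⟨hv, hs'⟩).trans (le_abs_self _)).trans
          ((le_max_left _ _).trans (le_max_right _ _)),
        ((h₃ (v, s) ⟨hv, hs'⟩).trans (le_abs_self _)).trans
          ((le_max_right _ _).trans (le_max_right _ _))⟩
    · rw [hout' v s hs hv]
      simp only [zero_apply, abs_zero, and_self]
      positivity

theorem tendsto_ratio {Y : ℝ} {X : ℕ → ℝ} (hX : Tendsto X atTop atTop) :
    Tendsto (fun n => X n / (Y + X n)) atTop (𝓝 1) := by
  have h1 : Tendsto (fun n => 1 - Y * (Y + X n)⁻¹) atTop (𝓝 (1 - Y * 0)) :=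
    tendsto_const_nhds.sub ((tendsto_atTop_add_const_left _ Y hX).inv_tendsto_atTop.const_mul Y)
  rw [mul_zero, sub_zero] at h1
  refine h1.congr' ?_
  filter_upwards [hX.eventually_gt_atTop (-Y)] with n hn
  have : Y + X n ≠ 0 := by linarith
  field_simp
  ring

/-- The parameters m increase to 2/τ while staying strictly below it; the shift by 2 keeps m
positive at n = 0. If v > -2/τ, both weights c·(form)² diverge and the quotients tend to 1.
Otherwise the lower form is nonpositive and every term is zero. -/
theorem tendsto_renormFn_zero {τ : ℝ} (hτ : 0 < τ) (v : ℝ) :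
    Tendsto (fun n : ℕ => renormFn (2 / τ * (1 - 1 / ((n : ℝ) + 2))) ((n : ℝ) + 1)
      ((n : ℝ) + 1) (v, 0)) atTop (𝓝 (if v > -2 / τ then v ^ 2 else 0)) := by
  have hn1 : Tendsto (fun n : ℕ => (n : ℝ) + 1) atTop atTop :=
    tendsto_atTop_add_const_right _ _ tendsto_natCast_atTop_atTop
  have hm : Tendsto (fun n : ℕ => v + 2 / τ * (1 - 1 / ((n : ℝ) + 2))) atTop
      (𝓝 (v + 2 / τ * (1 - 0))) := by
    refine tendsto_const_nhds.add (tendsto_const_nhds.mul (tendsto_const_nhds.sub ?_))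
    simp_rw [one_div]
    exact (tendsto_atTop_add_const_right _ _ tendsto_natCast_atTop_atTop).inv_tendsto_atTop
  rw [sub_zero, mul_one] at hm
  split_ifs with hv
  · have hpos : 0 < v + 2 / τ := by rw [neg_div] at hv; linarith
    have h1 : Tendsto (fun n : ℕ => ((n : ℝ) + 1) * sqPos (lowerForm
        (2 / τ * (1 - 1 / ((n : ℝ) + 2))) (v, 0))) atTop atTop := by
      refine hn1.atTop_mul_pos (C := sqPos (v + 2 / τ)) ?_ ?_
      · rw [sqPos_of_nonneg hpos.le]; positivity
      · have := (contDiff_sqPos.continuous.tendsto _).comp hm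
        simpa [lowerForm, Function.comp_def] using this
    have h2 : Tendsto (fun n : ℕ => ((n : ℝ) + 1) * sqPos (-lowerForm (-((n : ℝ) + 1)) (v, 0)))
        atTop atTop := by
      refine hn1.atTop_mul_atTop₀ ?_
      have h3 : Tendsto (fun n : ℕ => ((n : ℝ) + 1) + (-v)) atTop atTop :=
        tendsto_atTop_add_const_right _ _ hn1
      refine ((tendsto_pow_atTop (two_ne_zero)).comp h3).congr' ?_
      filter_upwards [h3.eventually_ge_atTop 0] with n hn
      rw [sqPos_of_nonneg (by simp only [lowerForm]; linarith)]
      simp only [lowerForm, Function.comp_apply]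
      ring
    have h4 := (((tendsto_ratio (Y := v ^ 2) h1).const_mul (v ^ 2)).mul
      (tendsto_ratio (Y := v ^ 2) h2))
    simpa [renormFn] using h4
  · refine tendsto_const_nhds.congr fun n => ?_
    have h1 : lowerForm (2 / τ * (1 - 1 / ((n : ℝ) + 2))) (v, 0) ≤ 0 := by
      have h2 : 0 ≤ 2 / τ * (1 / ((n : ℝ) + 2)) := by positivity
      rw [not_lt, neg_div] at hv
      simp only [lowerForm, mul_zero, zero_div, sub_zero, mul_one]
      linarith
    rw [renormFn, sqPos_of_nonpos h1]
    simp

end renormFn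

/-! ### Space-time regularity of finite-energy functions -/

theorem lintegral_le_of_tendsto_of_forall_le {α : Type*} [MeasurableSpace α] {μ : Measure α}
    {F : ℕ → α → ℝ≥0∞} {f : α → ℝ≥0∞} {Q : ℝ≥0∞} (hF : ∀ n, Measurable (F n))
    (hlim : ∀ᵐ x ∂μ, Tendsto (fun n => F n x) atTop (𝓝 (f x))) (hQ : ∀ n, ∫⁻ x, F n x ∂μ ≤ Q) :
    ∫⁻ x, f x ∂μ ≤ Q := by
  calc ∫⁻ x, f x ∂μ = ∫⁻ x, liminf (fun n => F n x) atTop ∂μ :=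
        lintegral_congr_ae (hlim.mono fun x hx => hx.liminf_eq.symm)
    _ ≤ liminf (fun n => ∫⁻ x, F n x ∂μ) atTop := lintegral_liminf_le hF
    _ ≤ liminf (fun _ : ℕ => Q) atTop := liminf_le_liminf (Eventually.of_forall hQ)
    _ = Q := liminf_const Q

/-- A continuous function of `(x, t)`, absolutely continuous in `x`, whose spatial derivative is
bounded in `L²` uniformly in time. -/
structure HasFiniteEnergy (U : ℝ → ℝ → ℝ) (Q : ℝ≥0∞) : Prop where
  continuous : Continuous fun p : ℝ × ℝ => U p.1 p.2
  absolutelyContinuous : ∀ t a b, AbsolutelyContinuousOnInterval (fun x => U x t) a b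
  energy_le : ∀ t, ∫⁻ x, ‖spatialDeriv U x t‖ₑ ^ 2 ≤ Q
  lt_top : Q < ⊤

/-- The energy `∫_{-∞}^x w²(y, t) dy` to the left of `x`. -/
noncomputable def leftEnergy (U : ℝ → ℝ → ℝ) (x t : ℝ) : ℝ := ∫ y in Iic x, spatialDeriv U y t ^ 2

/-- The time derivative `-u w + ½ ∫_{-∞}^x w²` prescribed by the Hunter-Saxton equation. -/
noncomputable def timeRate (U : ℝ → ℝ → ℝ) (x t : ℝ) : ℝ :=
  -(U x t * spatialDeriv U x t) + leftEnergy U x t / 2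

/-- The energy bound is given for almost every time only. At a fixed step the quotients depend
continuously on time, so Fatou along good times decreasing to t bounds them at t; a second use of
Fatou, as the step tends to zero, bounds the derivative itself. -/
theorem energy_le_of_ae {U : ℝ → ℝ → ℝ} {Q : ℝ≥0∞} (hQ : Q < ⊤)
    (hc : Continuous fun p : ℝ × ℝ => U p.1 p.2)
    (hac : ∀ t a b, AbsolutelyContinuousOnInterval (fun x => U x t) a b)
    (h : ∀ᵐ t, 0 ≤ t → ∫⁻ x, ‖spatialDeriv U x t‖ₑ ^ 2 ≤ Q) {t : ℝ} (ht : 0 ≤ t) :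
    ∫⁻ x, ‖spatialDeriv U x t‖ₑ ^ 2 ≤ Q := by
  have hd := Measure.dense_of_ae h
  have hex : ∀ n : ℕ, ∃ s, (0 ≤ s → ∫⁻ x, ‖spatialDeriv U x s‖ₑ ^ 2 ≤ Q) ∧
      s ∈ Ioo t (t + 1 / ((n : ℝ) + 1)) := fun n => by
    obtain ⟨s, hs1, hs2⟩ := hd.exists_between
      (show t < t + 1 / ((n : ℝ) + 1) from lt_add_of_pos_right _ (by positivity))
    exact ⟨s, hs1, hs2⟩
  choose s hs hst using hex
  have hlim : Tendsto s atTop (𝓝 t) := by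
    have h1 : Tendsto (fun n : ℕ => t + 1 / ((n : ℝ) + 1)) atTop (𝓝 (t + 0)) :=
      tendsto_const_nhds.add tendsto_one_div_add_atTop_nhds_zero_nat
    rw [add_zero] at h1
    exact tendsto_of_tendsto_of_tendsto_of_le_of_le tendsto_const_nhds h1
      (fun n => (hst n).1.le) fun n => (hst n).2.le
  have hcx : ∀ r, Continuous fun x => U x r := fun r =>
    hc.comp (by fun_prop : Continuous fun x : ℝ => (x, r))
  have hct : ∀ x, Continuous fun r => U x r := fun x =>
    hc.comp (by fun_prop : Continuous fun r : ℝ => (x, r))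
  have hquot : ∀ k : ℝ, 0 < k → ∫⁻ x, ‖fwdQuot k (fun y => U y t) x‖ₑ ^ 2 ≤ Q := fun k hk => by
    refine lintegral_le_of_tendsto_of_forall_le
      (F := fun n x => ‖fwdQuot k (fun y => U y (s n)) x‖ₑ ^ 2)
      (fun n => (measurable_fwdQuot (hcx _) k).enorm.pow_const 2)
      (Eventually.of_forall fun x => ?_) fun n => ?_
    · have h1 : Tendsto (fun n => fwdQuot k (fun y => U y (s n)) x) atTop
          (𝓝 (fwdQuot k (fun y => U y t) x)) :=
        ((((hct _).tendsto t).comp hlim).sub (((hct _).tendsto t).comp hlim)).div_const k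
      exact ENNReal.Tendsto.pow h1.enorm
    · have h0 := hs n (ht.trans (hst n).1.le)
      have hmem : MemLp (deriv fun y => U y (s n)) 2 volume := by
        refine ⟨(measurable_deriv _).aestronglyMeasurable, ?_⟩
        have := h0.trans_lt hQ
        unfold spatialDeriv at this
        rw [lintegral_enorm_sq_eq] at this
        exact (ENNReal.pow_lt_top_iff.1 this).resolve_right (by norm_num)
      exact (lintegral_fwdQuot_sq_le (hac (s n)) hmem hk).trans h0
  have hk : Tendsto (fun n : ℕ => 1 / ((n : ℝ) + 1)) atTop (𝓝[>] 0) :=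
    tendsto_nhdsWithin_iff.2 ⟨tendsto_one_div_add_atTop_nhds_zero_nat,
      Eventually.of_forall fun n => mem_Ioi.2 (by positivity)⟩
  refine lintegral_le_of_tendsto_of_forall_le
    (F := fun n x => ‖fwdQuot (1 / ((n : ℝ) + 1)) (fun y => U y t) x‖ₑ ^ 2)
    (fun n => (measurable_fwdQuot (hcx _) _).enorm.pow_const 2) ?_
    fun n => hquot _ (by positivity)
  filter_upwards [ae_hasDerivAt_of_absolutelyContinuous (hac t)] with x hx
  exact ENNReal.Tendsto.pow ((tendsto_fwdQuot hx).comp hk).enorm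

namespace HasFiniteEnergy

variable {U : ℝ → ℝ → ℝ} {Q : ℝ≥0∞}

theorem continuous_space (hU : HasFiniteEnergy U Q) (t : ℝ) : Continuous fun x => U x t :=
  hU.continuous.comp (by fun_prop : Continuous fun x : ℝ => (x, t))

theorem continuous_time (hU : HasFiniteEnergy U Q) (x : ℝ) : Continuous fun t => U x t :=
  hU.continuous.comp (by fun_prop : Continuous fun t : ℝ => (x, t))

theorem measurable_spatialDeriv (hU : HasFiniteEnergy U Q) :
    Measurable fun p : ℝ × ℝ => spatialDeriv U p.1 p.2 := by
  have h1 : Continuous (Function.uncurry fun t y => U y t) :=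
    hU.continuous.comp continuous_swap
  exact (measurable_deriv_with_param h1).comp measurable_swap

theorem memLp (hU : HasFiniteEnergy U Q) (t : ℝ) :
    MemLp (fun x => spatialDeriv U x t) 2 volume := by
  refine ⟨(measurable_deriv _).aestronglyMeasurable, ?_⟩
  have := (hU.energy_le t).trans_lt hU.lt_top
  rw [lintegral_enorm_sq_eq] at this
  exact (ENNReal.pow_lt_top_iff.1 this).resolve_right (by norm_num)

theorem integrable_sq (hU : HasFiniteEnergy U Q) (t : ℝ) :
    Integrable fun x => spatialDeriv U x t ^ 2 := (hU.memLp t).integrable_sq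

theorem integral_sq_le (hU : HasFiniteEnergy U Q) (t : ℝ) :
    ∫ x, spatialDeriv U x t ^ 2 ≤ Q.toReal := by
  rw [integral_eq_lintegral_of_nonneg_ae (Eventually.of_forall fun x => sq_nonneg _)
    (hU.integrable_sq t).1]
  simp_rw [← enorm_sq_eq_ofReal]
  exact ENNReal.toReal_mono hU.lt_top.ne (hU.energy_le t)

theorem leftEnergy_nonneg (x t : ℝ) : 0 ≤ leftEnergy U x t :=
  integral_nonneg fun _ => sq_nonneg _

theorem abs_leftEnergy_le (hU : HasFiniteEnergy U Q) (x t : ℝ) :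
    |leftEnergy U x t| ≤ Q.toReal := by
  rw [abs_of_nonneg (leftEnergy_nonneg x t)]
  exact (setIntegral_le_integral (hU.integrable_sq t)
    (Eventually.of_forall fun x => sq_nonneg _)).trans (hU.integral_sq_le t)

theorem measurable_leftEnergy (hU : HasFiniteEnergy U Q) :
    Measurable fun p : ℝ × ℝ => leftEnergy U p.1 p.2 := by
  have h1 : StronglyMeasurable (Function.uncurry fun (p : ℝ × ℝ) (y : ℝ) =>
      if y ≤ p.1 then spatialDeriv U y p.2 ^ 2 else 0) := by
    refine Measurable.stronglyMeasurable ?_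
    refine Measurable.ite (measurableSet_le measurable_snd (measurable_fst.comp measurable_fst))
      ?_ measurable_const
    exact (hU.measurable_spatialDeriv.comp
      (measurable_snd.prodMk (measurable_snd.comp measurable_fst))).pow_const 2
  have h2 := h1.integral_prod_right (ν := volume)
  convert h2.measurable using 2 with p
  rw [leftEnergy, ← integral_indicator measurableSet_Iic]
  simp only [indicator, mem_Iic]

theorem leftEnergy_sub (hU : HasFiniteEnergy U Q) (h x t : ℝ) :
    (leftEnergy U (x + h) t - leftEnergy U x t) / h
      = fwdMeanSq h (fun y => spatialDeriv U y t) x := by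
  rw [leftEnergy, leftEnergy, intervalIntegral.integral_Iic_sub_Iic
    (hU.integrable_sq t).integrableOn (hU.integrable_sq t).integrableOn, fwdMeanSq,
    intervalIntegral.integral_comp_add_left (fun y => spatialDeriv U y t ^ 2), add_zero,
    div_eq_inv_mul]

theorem integrable_spatialDeriv_prod (hU : HasFiniteEnergy U Q) (a b c d : ℝ) :
    Integrable (fun p : ℝ × ℝ => spatialDeriv U p.1 p.2)
      ((volume.restrict (Icc a b)).prod (volume.restrict (Icc c d))) := by
  refine ⟨hU.measurable_spatialDeriv.aestronglyMeasurable, ?_⟩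
  have h1 : ∀ r : ℝ, ‖r‖ₑ ≤ 1 + ‖r‖ₑ ^ 2 := fun r => by
    rw [enorm_sq_eq_ofReal, Real.enorm_eq_ofReal_abs, ← ENNReal.ofReal_one,
      ← ENNReal.ofReal_add zero_le_one (sq_nonneg _)]
    exact ENNReal.ofReal_le_ofReal (by nlinarith [sq_nonneg (|r| - 1), sq_abs r])
  rw [hasFiniteIntegral_iff_enorm, lintegral_prod_symm' _ hU.measurable_spatialDeriv.enorm]
  calc ∫⁻ s in Icc c d, ∫⁻ x in Icc a b, ‖spatialDeriv U x s‖ₑ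
      ≤ ∫⁻ _ in Icc c d, (volume (Icc a b) + Q) := by
        refine lintegral_mono fun s => ?_
        calc ∫⁻ x in Icc a b, ‖spatialDeriv U x s‖ₑ
            ≤ ∫⁻ x in Icc a b, (1 + ‖spatialDeriv U x s‖ₑ ^ 2) := lintegral_mono fun x => h1 _
          _ = volume (Icc a b) + ∫⁻ x in Icc a b, ‖spatialDeriv U x s‖ₑ ^ 2 := by
              rw [lintegral_add_left measurable_const]; simp
          _ ≤ _ := add_le_add le_rfl ((setLIntegral_le_lintegral _ _).trans (hU.energy_le s))
    _ < ⊤ := by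
        rw [setLIntegral_const]
        exact ENNReal.mul_lt_top (ENNReal.add_lt_top.2 ⟨measure_Icc_lt_top, hU.lt_top⟩)
          measure_Icc_lt_top

theorem exists_bound_box (hU : HasFiniteEnergy U Q) (a b c d : ℝ) :
    ∃ B : ℝ, ∀ x ∈ Icc a b, ∀ s ∈ Icc c d, |U x s| ≤ B := by
  obtain ⟨B, hB⟩ := (isCompact_Icc.prod isCompact_Icc : IsCompact (Icc a b ×ˢ Icc c d))
    |>.exists_bound_of_continuousOn hU.continuous.continuousOn
  exact ⟨B, fun x hx s hs => hB (x, s) ⟨hx, hs⟩⟩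

theorem integrable_timeRate_prod (hU : HasFiniteEnergy U Q) (a b c d : ℝ) :
    Integrable (fun p : ℝ × ℝ => timeRate U p.1 p.2)
      ((volume.restrict (Icc a b)).prod (volume.restrict (Icc c d))) := by
  obtain ⟨B, hB⟩ := hU.exists_bound_box a b c d
  have h1 : Integrable (fun p : ℝ × ℝ => U p.1 p.2 * spatialDeriv U p.1 p.2)
      ((volume.restrict (Icc a b)).prod (volume.restrict (Icc c d))) := by
    refine (hU.integrable_spatialDeriv_prod a b c d).bdd_mul (c := B)
      hU.continuous.aestronglyMeasurable ?_
    rw [Measure.prod_restrict, ae_restrict_iff' (measurableSet_Icc.prod measurableSet_Icc)]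
    exact Eventually.of_forall fun p hp => hB _ hp.1 _ hp.2
  have h2 : Integrable (fun p : ℝ × ℝ => leftEnergy U p.1 p.2 / 2)
      ((volume.restrict (Icc a b)).prod (volume.restrict (Icc c d))) := by
    refine Integrable.div_const ?_ 2
    refine Integrable.of_bound hU.measurable_leftEnergy.aestronglyMeasurable Q.toReal ?_
    exact Eventually.of_forall fun p => hU.abs_leftEnergy_le _ _
  exact h1.neg.add h2

end HasFiniteEnergy

/-! ### From the distributional equation to the evolution along vertical lines -/

/-- The du Bois-Reymond argument for m minus the primitive K of k. It is enough to test with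
smoothed indicators of [t₁, t₂], whose derivatives approximate δ at t₁ minus δ at t₂. -/
theorem sub_eq_integral_of_weak_deriv {m k : ℝ → ℝ} (hm : Continuous m)
    (hk : ∀ a b, IntervalIntegrable k volume a b)
    (H : ∀ η : ℝ → ℝ, ContDiff ℝ ∞ η → HasCompactSupport η → tsupport η ⊆ Ioi 0 →
      ∫ t in Ioi (0 : ℝ), (m t * deriv η t + k t * η t) = 0) {t : ℝ} (ht : 0 ≤ t) :
    m t = m 0 + ∫ s in (0 : ℝ)..t, k s := by
  set K : ℝ → ℝ := fun t => ∫ s in (0 : ℝ)..t, k s with hK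
  have hKc : Continuous K := intervalIntegral.continuous_primitive hk 0
  have hM : Continuous fun t => m t - K t := hm.sub hKc
  have key : ∀ t₁ t₂, 0 < t₁ → t₁ < t₂ → m t₁ - K t₁ = m t₂ - K t₂ := by
    intro t₁ t₂ h₁ h₂
    have hl := (tendsto_integral_deriv_smoothCut_mul hM t₁).sub
      (tendsto_integral_deriv_smoothCut_mul hM t₂)
    refine sub_eq_zero.1 (tendsto_nhds_unique hl (tendsto_const_nhds.congr' ?_))
    filter_upwards [self_mem_nhdsWithin] with ε hε
    have hε : 0 < ε := hε
    set η : ℝ → ℝ := fun t => smoothCut ε (t - t₁) - smoothCut ε (t - t₂) with hη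
    have hηd : ∀ n : ℕ∞, ContDiff ℝ n η := fun n =>
      (contDiff_smoothCut.comp (contDiff_id.sub contDiff_const)).sub
        (contDiff_smoothCut.comp (contDiff_id.sub contDiff_const))
    have hη0 : ∀ t, t ∉ Icc t₁ (t₂ + ε) → η t = 0 := fun t ht => by
      rw [mem_Icc, not_and_or, not_le, not_le] at ht
      rcases ht with ht | ht
      · simp only [hη]
        rw [smoothCut_of_nonpos hε (by linarith), smoothCut_of_nonpos hε (by linarith), sub_zero]
      · simp only [hη]
        rw [smoothCut_of_ge hε (by linarith), smoothCut_of_ge hε (by linarith), sub_self]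
    have hηs : tsupport η ⊆ Icc t₁ (t₂ + ε) :=
      closure_minimal (fun t ht => by by_contra h; exact ht (hη0 t h)) isClosed_Icc
    have hηc : HasCompactSupport η := HasCompactSupport.intro isCompact_Icc fun t ht => hη0 t ht
    have hη' : ∀ t, HasDerivAt η
        (deriv (smoothCut ε) (t - t₁) - deriv (smoothCut ε) (t - t₂)) t := fun t =>
      ((hasDerivAt_smoothCut _).comp_sub_const t t₁).sub
        ((hasDerivAt_smoothCut _).comp_sub_const t t₂)
    have hηt : ∀ t, t ∉ Icc t₁ (t₂ + ε) → deriv η t = 0 := fun t ht => by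
      have h3 : t ∉ tsupport η := fun h => ht (hηs h)
      have h4 : deriv η t ∈ ({0} : Set ℝ) := by
        have := support_deriv_subset (f := η)
        by_contra h5
        exact h3 (this (by simpa using h5))
      simpa using h4
    have e0 := H η (hηd _) hηc (hηs.trans fun t ht => h₁.trans_le ht.1)
    set B := t₂ + ε + 1 with hB
    have hB0 : 0 ≤ B := by linarith
    have e1 : ∫ t in (0 : ℝ)..B, (m t * deriv η t + k t * η t) = 0 := by
      rw [intervalIntegral.integral_of_le hB0]
      refine (setIntegral_eq_of_subset_of_forall_sdiff_eq_zero measurableSet_Ioi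
        Ioc_subset_Ioi_self ?_).symm.trans e0
      intro t ht
      have h5 : t ∉ Icc t₁ (t₂ + ε) := fun h => ht.2 ⟨ht.1, by linarith [h.2]⟩
      rw [hη0 t h5, hηt t h5]; ring
    have hηac : AbsolutelyContinuousOnInterval η 0 B :=
      (hηd 1).contDiffOn.absolutelyContinuousOnInterval
    have hKac : AbsolutelyContinuousOnInterval K 0 B :=
      (hk 0 B).absolutelyContinuousOnInterval_intervalIntegral left_mem_uIcc
    have hK' : ∀ᵐ t, t ∈ uIoc 0 B → HasDerivAt K (k t) t := by
      filter_upwards [(hk 0 B).ae_hasDerivAt_integral] with t ht ht'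
      exact ht (uIoc_subset_uIcc ht') 0 left_mem_uIcc
    have hηcont : Continuous (deriv η) := (hηd 1).continuous_deriv (by simp)
    -- Integration by parts moves k onto the primitive K; the boundary terms vanish since η is zero
    -- at 0 and at B, which lies beyond its support.
    have e2 : ∫ t in (0 : ℝ)..B, (deriv η t * K t + η t * k t) = 0 := by
      rw [(hηac.fun_mul hKac).integral_eq_sub_of_ae_hasDerivAt
        (f' := fun t => deriv η t * K t + η t * k t)]
      · rw [hη0 B (fun h => by linarith [h.2]), hη0 0 (fun h => by linarith [h.1])]
        ring
      · filter_upwards [hK'] with t ht ht'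
        exact ((hη' t).differentiableAt.hasDerivAt).mul (ht ht')
    have i1 : IntervalIntegrable (fun t => m t * deriv η t + k t * η t) volume 0 B :=
      ((hm.mul hηcont).intervalIntegrable _ _).add
        ((hk 0 B).mul_continuousOn (hηd 0).continuous.continuousOn)
    have i2 : IntervalIntegrable (fun t => deriv η t * K t + η t * k t) volume 0 B :=
      ((hηcont.mul hKc).intervalIntegrable _ _).add
        ((hk 0 B).continuousOn_mul (hηd 0).continuous.continuousOn)
    have e3 : ∫ t in (0 : ℝ)..B, deriv η t * (m t - K t) = 0 := by
      have e4 := intervalIntegral.integral_sub i1 i2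
      rw [e1, e2, sub_zero] at e4
      have e5 : (fun t => deriv η t * (m t - K t)) = fun t => m t * deriv η t + k t * η t
          - (deriv η t * K t + η t * k t) := by
        ext t; ring
      rw [e5, e4]
    have hint : ∀ a, Integrable fun t => deriv (smoothCut ε) (t - a) * (m t - K t) := fun a =>
      ((continuous_deriv_smoothCut.comp (continuous_sub_right a)).mul
        hM).integrable_of_hasCompactSupport
        (((hasCompactSupport_deriv_smoothCut hε).comp_homeomorph
          (Homeomorph.subRight a)).mul_right)
    rw [← integral_sub (hint t₁) (hint t₂), ← e3]
    rw [intervalIntegral.integral_eq_integral_of_support_subset]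
    · refine integral_congr_ae (Eventually.of_forall fun t => ?_)
      dsimp only
      rw [(hη' t).deriv]; ring
    · intro t ht
      by_contra h
      have h5 : t ∉ Icc t₁ (t₂ + ε) := fun h' => h ⟨h₁.trans_le h'.1, by linarith [h'.2]⟩
      exact ht (by simp [hηt t h5])
  -- The test functions only see t > 0; the value at 0 is reached by continuity.
  have hconst : m t - K t = m 0 - K 0 := by
    have h1 : Tendsto (fun s => m (t + s) - K (t + s)) (𝓝[>] 0) (𝓝 (m t - K t)) := by
      have : Continuous fun s => m (t + s) - K (t + s) := hM.comp (continuous_const_add t)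
      simpa using (this.tendsto 0).mono_left nhdsWithin_le_nhds
    have h2 : Tendsto (fun s => m s - K s) (𝓝[>] 0) (𝓝 (m 0 - K 0)) :=
      (hM.tendsto 0).mono_left nhdsWithin_le_nhds
    refine tendsto_nhds_unique h1 (h2.congr' ?_)
    filter_upwards [self_mem_nhdsWithin] with s hs
    have hs : 0 < s := hs
    rcases ht.eq_or_lt with rfl | ht
    · rw [zero_add]
    · exact key s (t + s) hs (by linarith)
  have : K 0 = 0 := by simp [hK]
  simp only [hK] at hconst this
  linarith

/-- The weak equation tested against products `χ(x) η(t)`. -/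
def IsWeakProductSolution (U : ℝ → ℝ → ℝ) : Prop :=
  ∀ χ η : ℝ → ℝ, ContDiff ℝ ∞ χ → HasCompactSupport χ → ContDiff ℝ ∞ η → HasCompactSupport η →
    tsupport η ⊆ Ioi 0 → ∫ t in Ioi (0 : ℝ), ∫ x : ℝ,
      (U x t * (χ x * deriv η t) + (1 / 2) * U x t ^ 2 * (deriv χ x * η t)
        + (1 / 2) * leftEnergy U x t * (χ x * η t)) = 0

/-! ### Integration by parts in space -/

namespace HasFiniteEnergy

variable {U : ℝ → ℝ → ℝ} {Q : ℝ≥0∞}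

/-- The difference of the integrands is half the derivative of u²χ, which integrates to zero because
χ has compact support. -/
theorem integral_flux_eq (hU : HasFiniteEnergy U Q) {χ : ℝ → ℝ} (hχ : ContDiff ℝ ∞ χ)
    (hχc : HasCompactSupport χ) (s : ℝ) :
    ∫ x, (1 / 2 * U x s ^ 2 * deriv χ x + 1 / 2 * leftEnergy U x s * χ x)
      = ∫ x, χ x * timeRate U x s := by
  obtain ⟨R, hR⟩ := hχc.isCompact.isBounded.subset_closedBall (0 : ℝ)
  rw [Real.closedBall_eq_Icc, zero_sub, zero_add] at hR
  -- Passing from R to |R| + 1 makes the interval nonempty and puts the support strictly inside it.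
  have hR' : ∀ x, x ∉ Ioc (-(|R| + 1)) (|R| + 1) → x ∉ tsupport χ := fun x hx h => by
    have h1 := hR h
    have h2 := le_abs_self R
    exact hx ⟨by linarith [h1.1], by linarith [h1.2]⟩
  have h0 : ∀ x, x ∉ Ioc (-(|R| + 1)) (|R| + 1) → χ x = 0 := fun x hx =>
    image_eq_zero_of_notMem_tsupport (hR' x hx)
  have h0' : ∀ x, x ∉ Ioc (-(|R| + 1)) (|R| + 1) → deriv χ x = 0 := fun x hx => by
    by_contra h
    exact hR' x hx (support_deriv_subset h)
  have hsupp : ∀ F : ℝ → ℝ, (∀ x, χ x = 0 → deriv χ x = 0 → F x = 0) →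
      ∫ x, F x = ∫ x in (-(|R| + 1))..(|R| + 1), F x := fun F hF => by
    refine (intervalIntegral.integral_eq_integral_of_support_subset fun x hx => ?_).symm
    by_contra h
    exact hx (hF x (h0 x h) (h0' x h))
  rw [hsupp _ fun x h1 h2 => by simp [h1, h2], hsupp _ fun x h1 _ => by simp [h1],
    ← sub_eq_zero]
  set A := |R| + 1
  have hUac := hU.absolutelyContinuous s (-A) A
  have hχac : AbsolutelyContinuousOnInterval χ (-A) A :=
    (hχ.of_le (by norm_cast)).contDiffOn.absolutelyContinuousOnInterval
  have hχ' : Continuous (deriv χ) := hχ.continuous_deriv (by norm_cast)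
  have hVm : Measurable fun x => leftEnergy U x s :=
    hU.measurable_leftEnergy.comp (measurable_id.prodMk measurable_const)
  have hV : IntervalIntegrable (fun x => leftEnergy U x s) volume (-A) A := by
    rw [intervalIntegrable_iff]
    have : IsFiniteMeasure (volume.restrict (uIoc (-A) A)) := ⟨by simp [uIoc]⟩
    exact Integrable.of_bound hVm.aestronglyMeasurable Q.toReal
      (Eventually.of_forall fun x => hU.abs_leftEnergy_le x s)
  have hd := ae_hasDerivAt_of_absolutelyContinuous (hU.absolutelyContinuous s)
  have hw : IntervalIntegrable (fun x => spatialDeriv U x s) volume (-A) A :=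
    hUac.intervalIntegrable_deriv
  have hc := (hU.continuous_space s)
  have i1 : IntervalIntegrable (fun x => 1 / 2 * U x s ^ 2 * deriv χ x
      + 1 / 2 * leftEnergy U x s * χ x) volume (-A) A :=
    (Continuous.intervalIntegrable (by fun_prop) _ _).add
      ((hV.const_mul (1 / 2)).mul_continuousOn hχ.continuous.continuousOn)
  have i2 : IntervalIntegrable (fun x => χ x * timeRate U x s) volume (-A) A :=
    (((hw.continuousOn_mul hc.continuousOn).neg).add (hV.div_const 2)).continuousOn_mul
      hχ.continuous.continuousOn
  rw [← intervalIntegral.integral_sub i1 i2]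
  have e := ((hUac.fun_mul hUac).fun_mul hχac).integral_eq_sub_of_ae_hasDerivAt
    (f' := fun x => (spatialDeriv U x s * U x s + U x s * spatialDeriv U x s) * χ x
      + U x s * U x s * deriv χ x) (by
      filter_upwards [hd] with x hx _
      exact (hx.mul hx).mul
        (hχ.differentiable (by simp) x).hasDerivAt)
  rw [h0 (-A) (fun h => lt_irrefl _ h.1)] at e
  have hA : χ A = 0 := by
    refine image_eq_zero_of_notMem_tsupport fun h => ?_
    have := (hR h).2
    have h2 := le_abs_self R
    have h3 : A = |R| + 1 := rfl
    linarith
  rw [hA, mul_zero, mul_zero, sub_zero] at e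
  rw [← mul_zero (1 / 2 : ℝ), ← e, ← intervalIntegral.integral_const_mul]
  refine intervalIntegral.integral_congr fun x _ => ?_
  simp only [timeRate]
  ring

end HasFiniteEnergy

/-! ### Evolution along almost every vertical line -/

namespace HasFiniteEnergy

variable {U : ℝ → ℝ → ℝ} {Q : ℝ≥0∞}

theorem exists_Icc_of_hasCompactSupport {χ : ℝ → ℝ} (hχc : HasCompactSupport χ) :
    ∃ R, tsupport χ ⊆ Icc (-R) R := by
  obtain ⟨R, hR⟩ := hχc.isCompact.isBounded.subset_closedBall (0 : ℝ)
  rw [Real.closedBall_eq_Icc, zero_sub, zero_add] at hR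
  exact ⟨R, hR⟩

theorem integrable_mul_timeRate_prod (hU : HasFiniteEnergy U Q) {χ : ℝ → ℝ} (hχ : Continuous χ)
    (hχc : HasCompactSupport χ) (a b c d : ℝ) :
    Integrable (fun p : ℝ × ℝ => χ p.1 * timeRate U p.1 p.2)
      ((volume.restrict (Icc a b)).prod (volume.restrict (Icc c d))) := by
  obtain ⟨B, hB⟩ := hχ.bounded_above_of_compact_support hχc
  exact (hU.integrable_timeRate_prod a b c d).bdd_mul (c := B)
    (hχ.comp continuous_fst).aestronglyMeasurable (Eventually.of_forall fun p => hB p.1)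

theorem integral_mul_eq_setIntegral {χ F : ℝ → ℝ} {R : ℝ} (hR : tsupport χ ⊆ Icc (-R) R) :
    ∫ x, χ x * F x = ∫ x in Icc (-R) R, χ x * F x := by
  refine (setIntegral_eq_integral_of_forall_compl_eq_zero fun x hx => ?_).symm
  rw [image_eq_zero_of_notMem_tsupport fun h => hx (hR h), zero_mul]

theorem intervalIntegrable_integral_mul_timeRate (hU : HasFiniteEnergy U Q) {χ : ℝ → ℝ}
    (hχ : Continuous χ) (hχc : HasCompactSupport χ) (a b : ℝ) :
    IntervalIntegrable (fun s => ∫ x, χ x * timeRate U x s) volume a b := by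
  obtain ⟨R, hR⟩ := exists_Icc_of_hasCompactSupport hχc
  simp_rw [integral_mul_eq_setIntegral hR]
  have h1 := (hU.integrable_mul_timeRate_prod hχ hχc (-R) R (min a b)
    (max a b)).integral_prod_right
  rw [intervalIntegrable_iff]
  exact IntegrableOn.mono_set h1 uIoc_subset_uIcc

theorem continuous_integral_mul (hU : HasFiniteEnergy U Q) {χ : ℝ → ℝ}
    (hχ : Continuous χ) (hχc : HasCompactSupport χ) :
    Continuous fun t => ∫ x, χ x * U x t := by
  obtain ⟨R, hR⟩ := exists_Icc_of_hasCompactSupport hχc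
  simp_rw [integral_mul_eq_setIntegral hR]
  have hc := hU.continuous
  refine continuous_parametric_integral_of_continuous (f := fun t x => χ x * U x t) ?_
    isCompact_Icc
  exact (hχ.comp continuous_snd).mul (hc.comp continuous_swap)

theorem integral_mul_eq_add (hU : HasFiniteEnergy U Q) (hw : IsWeakProductSolution U)
    {χ : ℝ → ℝ} (hχ : ContDiff ℝ ∞ χ) (hχc : HasCompactSupport χ) {t : ℝ} (ht : 0 ≤ t) :
    ∫ x, χ x * U x t = (∫ x, χ x * U x 0) + ∫ s in (0 : ℝ)..t, ∫ x, χ x * timeRate U x s := by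
  refine sub_eq_integral_of_weak_deriv (m := fun t => ∫ x, χ x * U x t)
    (k := fun s => ∫ x, χ x * timeRate U x s) (hU.continuous_integral_mul hχ.continuous hχc)
    (hU.intervalIntegrable_integral_mul_timeRate hχ.continuous hχc) (fun η hη hηc hηs => ?_) ht
  refine Eq.trans ?_ (hw χ η hχ hχc hη hηc hηs)
  refine setIntegral_congr_fun measurableSet_Ioi fun s _ => ?_
  rw [← hU.integral_flux_eq hχ hχc s, ← integral_mul_const, ← integral_mul_const,
    ← integral_add]
  · refine integral_congr_ae (Eventually.of_forall fun x => ?_)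
    dsimp only
    ring
  · refine Integrable.mul_const ?_ _
    exact (hχ.continuous.mul (hU.continuous_space s)).integrable_of_hasCompactSupport
      hχc.mul_right
  · refine Integrable.mul_const ?_ _
    have hc := hU.continuous_space s
    have hχ' : Continuous (deriv χ) := hχ.continuous_deriv (by norm_cast)
    refine Integrable.add ?_ ?_
    · exact Continuous.integrable_of_hasCompactSupport (by fun_prop) hχc.deriv.mul_left
    · refine (hχ.continuous.integrable_of_hasCompactSupport hχc).bdd_mul
        (c := 1 / 2 * Q.toReal) ?_ (Eventually.of_forall fun x => ?_)
      · exact ((hU.measurable_leftEnergy.comp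
          (measurable_id.prodMk measurable_const)).const_mul _).aestronglyMeasurable
      · rw [norm_mul, Real.norm_of_nonneg (by norm_num : (0 : ℝ) ≤ 1 / 2)]
        exact mul_le_mul_of_nonneg_left (hU.abs_leftEnergy_le x s) (by norm_num)

/-- By Fubini the difference of the two sides is orthogonal to every smooth compactly supported χ,
hence is zero almost everywhere. The exceptional set still depends on t. -/
theorem ae_eq_add_integral (hU : HasFiniteEnergy U Q) (hw : IsWeakProductSolution U)
    {t : ℝ} (ht : 0 ≤ t) :
    ∀ᵐ x, U x t = U x 0 + ∫ s in (0 : ℝ)..t, timeRate U x s := by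
  have hint : ∀ R : ℝ, IntegrableOn (fun x => ∫ s in (0 : ℝ)..t, timeRate U x s)
      (Icc (-R) R) := fun R => by
    have h1 := (hU.integrable_timeRate_prod (-R) R 0 t).integral_prod_left
    simp_rw [intervalIntegral.integral_of_le ht, ← integral_Icc_eq_integral_Ioc]
    exact h1
  have hloc : LocallyIntegrable fun x => U x t - (U x 0 + ∫ s in (0 : ℝ)..t, timeRate U x s) := by
    refine (hU.continuous_space t).locallyIntegrable.sub
      ((hU.continuous_space 0).locallyIntegrable.add ?_)
    intro x
    refine ⟨Icc (-(|x| + 1)) (|x| + 1), Icc_mem_nhds ?_ ?_, hint _⟩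
    · linarith [neg_abs_le x]
    · linarith [le_abs_self x]
  have h0 := ae_eq_zero_of_integral_contDiff_smul_eq_zero hloc fun χ hχ hχc => by
    obtain ⟨R, hR⟩ := exists_Icc_of_hasCompactSupport hχc
    have e := hU.integral_mul_eq_add hw hχ hχc ht
    have hχi : ∀ r, Integrable fun x => χ x * U x r := fun r =>
      (hχ.continuous.mul (hU.continuous_space r)).integrable_of_hasCompactSupport hχc.mul_right
    have hp := hU.integrable_mul_timeRate_prod hχ.continuous hχc (-R) R 0 t
    have hgi : Integrable fun x => χ x * ∫ s in (0 : ℝ)..t, timeRate U x s := by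
      have h3 : IntegrableOn (fun x => χ x * ∫ s in (0 : ℝ)..t, timeRate U x s) (Icc (-R) R) := by
        have := hp.integral_prod_left
        simp_rw [integral_const_mul] at this
        simp_rw [intervalIntegral.integral_of_le ht, ← integral_Icc_eq_integral_Ioc]
        exact this
      rw [← integrableOn_univ]
      refine h3.of_forall_sdiff_eq_zero MeasurableSet.univ fun x hx => ?_
      rw [image_eq_zero_of_notMem_tsupport fun h => hx.2 (hR h), zero_mul]
    have hfub : ∫ s in (0 : ℝ)..t, ∫ x, χ x * timeRate U x s
        = ∫ x, χ x * ∫ s in (0 : ℝ)..t, timeRate U x s := by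
      rw [integral_mul_eq_setIntegral hR]
      simp_rw [integral_mul_eq_setIntegral hR, intervalIntegral.integral_of_le ht,
        ← integral_Icc_eq_integral_Ioc, ← integral_const_mul]
      exact (integral_integral_swap hp).symm
    simp_rw [smul_eq_mul, mul_sub, mul_add]
    rw [integral_sub (hχi t) (Integrable.add (hχi 0) hgi :
      Integrable fun x => χ x * U x 0 + χ x * ∫ s in (0 : ℝ)..t, timeRate U x s),
      integral_add (hχi 0) hgi, e, hfub, sub_self]
  filter_upwards [h0] with x hx using sub_eq_zero.1 hx

theorem ae_intervalIntegrable_timeRate (hU : HasFiniteEnergy U Q) {τ : ℝ} (hτ : 0 ≤ τ) :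
    ∀ᵐ x, IntervalIntegrable (fun s => timeRate U x s) volume 0 τ := by
  have h1 : ∀ n : ℕ, ∀ᵐ x, x ∈ Icc (-(n : ℝ)) n →
      IntervalIntegrable (fun s => timeRate U x s) volume 0 τ := fun n => by
    rw [← ae_restrict_iff' measurableSet_Icc]
    filter_upwards [(hU.integrable_timeRate_prod (-(n : ℝ)) n 0 τ).prod_right_ae] with x hx
    rw [intervalIntegrable_iff, uIoc_of_le hτ]
    exact IntegrableOn.mono_set hx Ioc_subset_Icc_self
  filter_upwards [ae_all_iff.2 h1] with x hx
  obtain ⟨n, hn⟩ := exists_nat_ge |x|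
  exact hx n (abs_le.1 hn)

/-- A single null set serves all times: discard those of the rational times, then extend by
continuity in t of both sides. -/
theorem ae_forall_eq_add_integral (hU : HasFiniteEnergy U Q) (hw : IsWeakProductSolution U)
    {τ : ℝ} (hτ : 0 < τ) :
    ∀ᵐ x, IntervalIntegrable (fun s => timeRate U x s) volume 0 τ ∧
      ∀ t ∈ Icc 0 τ, U x t = U x 0 + ∫ s in (0 : ℝ)..t, timeRate U x s := by
  have h1 : ∀ q : ℚ, ∀ᵐ x, 0 ≤ (q : ℝ) → U x q = U x 0 + ∫ s in (0 : ℝ)..q, timeRate U x s :=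
    fun q => by
      by_cases hq : 0 ≤ (q : ℝ)
      · filter_upwards [hU.ae_eq_add_integral hw hq] with x hx _ using hx
      · exact Eventually.of_forall fun x h => absurd h hq
  filter_upwards [ae_all_iff.2 h1, hU.ae_intervalIntegrable_timeRate hτ.le] with x hx hxi
  refine ⟨hxi, ?_⟩
  have hc1 : ContinuousOn (fun t => U x t) (Icc 0 τ) := (hU.continuous_time x).continuousOn
  have hc2 : ContinuousOn (fun t => U x 0 + ∫ s in (0 : ℝ)..t, timeRate U x s) (Icc 0 τ) := by
    have := hxi.absolutelyContinuousOnInterval_intervalIntegral (c := 0) left_mem_uIcc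
    have h2 := this.continuousOn
    rw [uIcc_of_le hτ.le] at h2
    exact continuousOn_const.add h2
  have hd : Icc 0 τ ⊆ closure (Ioo 0 τ ∩ range ((↑) : ℚ → ℝ)) := by
    rw [← closure_Ioo hτ.ne]
    exact closure_minimal ((Rat.denseRange_cast (𝕜 := ℝ)).open_subset_closure_inter isOpen_Ioo)
      isClosed_closure
  have heq : EqOn (fun t => U x t) (fun t => U x 0 + ∫ s in (0 : ℝ)..t, timeRate U x s)
      (Ioo 0 τ ∩ range ((↑) : ℚ → ℝ)) := by
    rintro _ ⟨ht, q, rfl⟩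
    exact hx q ht.1.le
  exact heq.of_subset_closure hc1 hc2
    (inter_subset_left.trans Ioo_subset_Icc_self) hd

end HasFiniteEnergy

/-! ### The renormalized balance between two characteristics -/

/-- A globally Lipschitz path which is a characteristic on `(0, τ)`. -/
structure IsLipschitzPath (U : ℝ → ℝ → ℝ) (τ : ℝ) (p : ℝ → ℝ) : Prop where
  lipschitz : ∃ K : ℝ≥0, LipschitzWith K p
  hasDerivAt : ∀ᵐ s, s ∈ Ioo 0 τ → HasDerivAt p (U (p s) s) s

theorem IsLipschitzPath.continuous {U : ℝ → ℝ → ℝ} {τ : ℝ} {p : ℝ → ℝ}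
    (hp : IsLipschitzPath U τ p) : Continuous p :=
  let ⟨_, hK⟩ := hp.lipschitz; hK.continuous

/-- A smooth cut-off in `x` to the interval `(p s, q s)`. -/
noncomputable def strip (ε : ℝ) (p q : ℝ → ℝ) (x s : ℝ) : ℝ :=
  smoothCut ε (x - p s) * smoothCut ε (q s - x)

/-- The time derivative of `strip` when `p` and `q` are characteristics. -/
noncomputable def stripDt (ε : ℝ) (p q : ℝ → ℝ) (U : ℝ → ℝ → ℝ) (x s : ℝ) : ℝ :=
  deriv (smoothCut ε) (x - p s) * (-U (p s) s) * smoothCut ε (q s - x)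
    + smoothCut ε (x - p s) * (deriv (smoothCut ε) (q s - x) * U (q s) s)

/-- The space derivative of `strip`. -/
noncomputable def stripDx (ε : ℝ) (p q : ℝ → ℝ) (x s : ℝ) : ℝ :=
  deriv (smoothCut ε) (x - p s) * smoothCut ε (q s - x)
    + smoothCut ε (x - p s) * (deriv (smoothCut ε) (q s - x) * (-1))

/-! ### The moving strip and its edge errors -/

section strip

variable {ε τ : ℝ} {p q : ℝ → ℝ} {U : ℝ → ℝ → ℝ}

theorem strip_nonneg (x s : ℝ) : 0 ≤ strip ε p q x s :=
  mul_nonneg (smoothCut_nonneg _) (smoothCut_nonneg _)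

theorem strip_le_one (x s : ℝ) : strip ε p q x s ≤ 1 :=
  mul_le_one₀ (smoothCut_le_one _) (smoothCut_nonneg _) (smoothCut_le_one _)

theorem strip_eq_zero (hε : 0 < ε) {x s : ℝ} (h : x ∉ Ioo (p s) (q s)) :
    strip ε p q x s = 0 := by
  rw [mem_Ioo, not_and_or, not_lt, not_lt] at h
  rcases h with h | h
  · rw [strip, smoothCut_of_nonpos hε (by linarith), zero_mul]
  · rw [strip, smoothCut_of_nonpos hε (by linarith : q s - x ≤ 0), mul_zero]

theorem hasDerivAt_strip_time {x s : ℝ} (hp : HasDerivAt p (U (p s) s) s)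
    (hq : HasDerivAt q (U (q s) s) s) :
    HasDerivAt (fun s => strip ε p q x s) (stripDt ε p q U x s) s := by
  have h1 := (hasDerivAt_smoothCut (ε := ε) (x - p s)).comp s (hp.const_sub x)
  have h2 := (hasDerivAt_smoothCut (ε := ε) (q s - x)).comp s (hq.sub_const x)
  exact h1.mul h2

theorem hasDerivAt_strip_space (x s : ℝ) :
    HasDerivAt (fun x => strip ε p q x s) (stripDx ε p q x s) x := by
  refine HasDerivAt.mul ?_ ?_
  · exact (hasDerivAt_smoothCut (x - p s)).comp_sub_const x (p s)
  · exact (hasDerivAt_smoothCut (q s - x)).comp x ((hasDerivAt_id x).const_sub (q s))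

theorem contDiff_strip_space (s : ℝ) {n : ℕ∞} : ContDiff ℝ n fun x => strip ε p q x s :=
  (contDiff_smoothCut.comp (contDiff_id.sub contDiff_const)).mul
    (contDiff_smoothCut.comp (contDiff_const.sub contDiff_id))

theorem absolutelyContinuous_strip_time (hp : IsLipschitzPath U τ p) (hq : IsLipschitzPath U τ q)
    (x a b : ℝ) : AbsolutelyContinuousOnInterval (fun s => strip ε p q x s) a b := by
  obtain ⟨K, hK⟩ := hp.lipschitz
  obtain ⟨L, hL⟩ := hq.lipschitz
  have h1 : AbsolutelyContinuousOnInterval p a b :=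
    (hK.lipschitzOnWith (s := uIcc a b)).absolutelyContinuousOnInterval
  have h2 : AbsolutelyContinuousOnInterval q a b :=
    (hL.lipschitzOnWith (s := uIcc a b)).absolutelyContinuousOnInterval
  refine AbsolutelyContinuousOnInterval.fun_mul ?_ ?_
  · exact h1.comp_contDiff (Φ := fun y => smoothCut ε (x - y))
      (contDiff_smoothCut.comp (contDiff_const.sub contDiff_id))
  · exact h2.comp_contDiff (Φ := fun y => smoothCut ε (y - x))
      (contDiff_smoothCut.comp (contDiff_id.sub contDiff_const))

theorem continuous_strip (hp : Continuous p) (hq : Continuous q) :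
    Continuous fun z : ℝ × ℝ => strip ε p q z.1 z.2 := by
  have h : Continuous (smoothCut ε) := (contDiff_smoothCut (n := 0)).continuous
  unfold strip
  fun_prop

theorem continuous_stripDx (hp : Continuous p) (hq : Continuous q) :
    Continuous fun z : ℝ × ℝ => stripDx ε p q z.1 z.2 := by
  have h : Continuous (smoothCut ε) := (contDiff_smoothCut (n := 0)).continuous
  have h' : Continuous (deriv (smoothCut ε)) := continuous_deriv_smoothCut
  unfold stripDx
  fun_prop

theorem continuous_stripDt (hp : Continuous p) (hq : Continuous q)
    (hU : Continuous fun z : ℝ × ℝ => U z.1 z.2) :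
    Continuous fun z : ℝ × ℝ => stripDt ε p q U z.1 z.2 := by
  have h : Continuous (smoothCut ε) := (contDiff_smoothCut (n := 0)).continuous
  have h' : Continuous (deriv (smoothCut ε)) := continuous_deriv_smoothCut
  have h1 : Continuous fun z : ℝ × ℝ => U (p z.2) z.2 :=
    hU.comp ((hp.comp continuous_snd).prodMk continuous_snd)
  have h2 : Continuous fun z : ℝ × ℝ => U (q z.2) z.2 :=
    hU.comp ((hq.comp continuous_snd).prodMk continuous_snd)
  unfold stripDt
  fun_prop

/-- An edge of the strip moves with the velocity on its characteristic, while the flux carries u(x +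
h). Where a cut-off derivative is nonzero, x + h lies within ε + h of that edge, so the velocities
differ by at most ρ. -/
theorem abs_stripDt_add_le (hε : 0 < ε) {ρ h s : ℝ} (hh : 0 ≤ h)
    (hρp : ∀ y, |y - p s| ≤ ε + h → |U y s - U (p s) s| ≤ ρ)
    (hρq : ∀ y, |y - q s| ≤ ε + h → |U y s - U (q s) s| ≤ ρ) (x : ℝ) :
    |stripDt ε p q U x s + stripDx ε p q x s * U (x + h) s|
      ≤ ρ * (deriv (smoothCut ε) (x - p s) + deriv (smoothCut ε) (q s - x)) := by
  have e : stripDt ε p q U x s + stripDx ε p q x s * U (x + h) s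
      = smoothCut ε (q s - x) * (deriv (smoothCut ε) (x - p s) * (U (x + h) s - U (p s) s))
        - smoothCut ε (x - p s) * (deriv (smoothCut ε) (q s - x)
          * (U (x + h) s - U (q s) s)) := by
    rw [stripDt, stripDx]; ring
  have key : ∀ d k a : ℝ, 0 ≤ k → k ≤ 1 → 0 ≤ d → (d ≠ 0 → |a| ≤ ρ) → |k * (d * a)| ≤ ρ * d := by
    intro d k a hk hk1 hd ha
    rcases eq_or_ne d 0 with rfl | hd0
    · simp
    · rw [abs_mul, abs_mul, abs_of_nonneg hk, abs_of_nonneg hd, mul_comm ρ]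
      exact (mul_le_of_le_one_left (by positivity) hk1).trans
        (mul_le_mul_of_nonneg_left (ha hd0) hd)
  rw [e, mul_add]
  refine (abs_sub _ _).trans (add_le_add ?_ ?_)
  · refine key _ _ _ (smoothCut_nonneg _) (smoothCut_le_one _) (deriv_smoothCut_nonneg hε _)
      fun hd => hρp _ ?_
    have := not_imp_comm.1 (deriv_smoothCut_eq_zero hε) hd
    rw [abs_le]; constructor <;> linarith [this.1, this.2]
  · refine key _ _ _ (smoothCut_nonneg _) (smoothCut_le_one _) (deriv_smoothCut_nonneg hε _)
      fun hd => hρq _ ?_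
    have := not_imp_comm.1 (deriv_smoothCut_eq_zero hε) hd
    rw [abs_le]; constructor <;> linarith [this.1, this.2]

/-- Each edge profile has mass one whatever ε is, so the two edges cost 2Cρ although the profiles
become steep. -/
theorem lintegral_stripDt_add_le (hε : 0 < ε) {ρ h s C : ℝ} (hh : 0 ≤ h) (hρ : 0 ≤ ρ) (hC : 0 ≤ C)
    (hρp : ∀ y, |y - p s| ≤ ε + h → |U y s - U (p s) s| ≤ ρ)
    (hρq : ∀ y, |y - q s| ≤ ε + h → |U y s - U (q s) s| ≤ ρ) {β : ℝ → ℝ} (hβ : ∀ x, |β x| ≤ C)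
    (S : Set ℝ) :
    ∫⁻ x in S, ‖β x * (stripDt ε p q U x s + stripDx ε p q x s * U (x + h) s)‖ₑ
      ≤ ENNReal.ofReal (2 * C * ρ) := by
  have hi1 : Integrable fun x => deriv (smoothCut ε) (x - p s) :=
    (integrable_deriv_smoothCut hε).comp_sub_right (p s)
  have hi2 : Integrable fun x => deriv (smoothCut ε) (q s - x) :=
    (integrable_deriv_smoothCut hε).comp_sub_left (q s)
  calc ∫⁻ x in S, ‖β x * (stripDt ε p q U x s + stripDx ε p q x s * U (x + h) s)‖ₑ
      ≤ ∫⁻ x, ENNReal.ofReal (C * (ρ * (deriv (smoothCut ε) (x - p s)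
          + deriv (smoothCut ε) (q s - x)))) := by
        refine (setLIntegral_le_lintegral _ _).trans (lintegral_mono fun x => ?_)
        rw [Real.enorm_eq_ofReal_abs, abs_mul]
        refine ENNReal.ofReal_le_ofReal ?_
        exact mul_le_mul (hβ x) (abs_stripDt_add_le hε hh hρp hρq x) (abs_nonneg _) hC
    _ = ENNReal.ofReal (∫ x, C * (ρ * (deriv (smoothCut ε) (x - p s)
          + deriv (smoothCut ε) (q s - x)))) := by
        refine (ofReal_integral_eq_lintegral_ofReal
          (((hi1.add hi2).const_mul ρ).const_mul C) ?_).symm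
        refine Eventually.of_forall fun x => ?_
        exact mul_nonneg hC (mul_nonneg hρ (add_nonneg (deriv_smoothCut_nonneg hε _)
          (deriv_smoothCut_nonneg hε _)))
    _ = ENNReal.ofReal (2 * C * ρ) := by
        rw [integral_const_mul, integral_const_mul, integral_add hi1 hi2,
          integral_deriv_smoothCut_sub_right hε, integral_deriv_smoothCut_sub_left hε]
        congr 1; ring

end strip

/-- The integrand of the renormalized balance obtained by differentiating in time. -/
noncomputable def timeIntegrand (b : ℝ × ℝ → ℝ) (ε h : ℝ) (p q : ℝ → ℝ) (U : ℝ → ℝ → ℝ)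
    (x s : ℝ) : ℝ :=
  stripDt ε p q U x s * b (fwdQuot h (fun y => U y s) x, s)
    + strip ε p q x s
      * (fderiv ℝ b (fwdQuot h (fun y => U y s) x, s) (1, 0)
          * fwdQuot h (fun y => timeRate U y s) x
        + fderiv ℝ b (fwdQuot h (fun y => U y s) x, s) (0, 1))

/-- The `x`-derivative of the flux `strip * b(wₕ) * u(x + h)`. -/
noncomputable def spaceIntegrand (b : ℝ × ℝ → ℝ) (ε h : ℝ) (p q : ℝ → ℝ) (U : ℝ → ℝ → ℝ)
    (x s : ℝ) : ℝ :=
  (stripDx ε p q x s * b (fwdQuot h (fun y => U y s) x, s)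
    + strip ε p q x s
      * (fderiv ℝ b (fwdQuot h (fun y => U y s) x, s) (1, 0)
          * fwdQuot h (fun y => spatialDeriv U y s) x)) * U (x + h) s
    + strip ε p q x s * b (fwdQuot h (fun y => U y s) x, s) * spatialDeriv U (x + h) s

/-- `renormResidual` for the renormalization function `b` at time `s`. -/
noncomputable def residualAt (b : ℝ × ℝ → ℝ) (h : ℝ) (U : ℝ → ℝ → ℝ) (x s : ℝ) : ℝ :=
  renormResidual (fun v => b (v, s)) (fun v => fderiv ℝ b (v, s) (1, 0))
    (fun v => fderiv ℝ b (v, s) (0, 1)) h (fun y => U y s) x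

theorem fderiv_apply_eq (b : ℝ × ℝ → ℝ) (z : ℝ × ℝ) (c d : ℝ) :
    fderiv ℝ b z (c, d) = fderiv ℝ b z (1, 0) * c + fderiv ℝ b z (0, 1) * d := by
  have : ((c, d) : ℝ × ℝ) = c • ((1, 0) : ℝ × ℝ) + d • ((0, 1) : ℝ × ℝ) := by simp
  rw [this, map_add, map_smul, map_smul, smul_eq_mul, smul_eq_mul]
  ring

/-! ### The balance law at positive step h -/

namespace HasFiniteEnergy

variable {U : ℝ → ℝ → ℝ} {Q : ℝ≥0∞} {b : ℝ × ℝ → ℝ} {ε h τ : ℝ} {p q : ℝ → ℝ}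

/-- The discrete Leibniz rule writes the quotient of u w as u(x + h) times the quotient of w, plus w
w_h. With transport velocity u(x + h) the quotient of w cancels, and the nonlocal term leaves half
the mean of w². -/
theorem timeIntegrand_add_spaceIntegrand (hU : HasFiniteEnergy U Q) (x s : ℝ) :
    timeIntegrand b ε h p q U x s + spaceIntegrand b ε h p q U x s
      = b (fwdQuot h (fun y => U y s) x, s)
          * (stripDt ε p q U x s + stripDx ε p q x s * U (x + h) s)
        + strip ε p q x s * residualAt b h U x s := by
  have e : fwdQuot h (fun y => timeRate U y s) x
      + fwdQuot h (fun y => spatialDeriv U y s) x * U (x + h) s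
      = fwdMeanSq h (deriv fun y => U y s) x / 2
        - deriv (fun y => U y s) x * fwdQuot h (fun y => U y s) x := by
    have := hU.leftEnergy_sub h x s
    change _ = fwdMeanSq h (deriv fun y => U y s) x at this
    rw [← this]
    simp only [fwdQuot, timeRate, spatialDeriv]
    ring
  have e2 : timeIntegrand b ε h p q U x s + spaceIntegrand b ε h p q U x s
      = b (fwdQuot h (fun y => U y s) x, s)
          * (stripDt ε p q U x s + stripDx ε p q x s * U (x + h) s)
        + strip ε p q x s * (fderiv ℝ b (fwdQuot h (fun y => U y s) x, s) (0, 1)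
          + fderiv ℝ b (fwdQuot h (fun y => U y s) x, s) (1, 0)
            * (fwdQuot h (fun y => timeRate U y s) x
              + fwdQuot h (fun y => spatialDeriv U y s) x * U (x + h) s)
          + b (fwdQuot h (fun y => U y s) x, s) * spatialDeriv U (x + h) s) := by
    rw [timeIntegrand, spaceIntegrand]; ring
  rw [e2, e]
  rfl

theorem absolutelyContinuous_fwdQuot (hU : HasFiniteEnergy U Q) (h s a c : ℝ) :
    AbsolutelyContinuousOnInterval (fwdQuot h fun y => U y s) a c := by
  have h1 := ((hU.absolutelyContinuous s (a + h) (c + h)).comp_add_right).fun_sub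
    (hU.absolutelyContinuous s a c)
  convert h1.const_mul h⁻¹ using 2 with x
  rw [fwdQuot, div_eq_inv_mul]

theorem ae_hasDerivAt_fwdQuot (hU : HasFiniteEnergy U Q) (h s : ℝ) :
    ∀ᵐ x, HasDerivAt (fwdQuot h fun y => U y s) (fwdQuot h (fun y => spatialDeriv U y s) x) x ∧
      HasDerivAt (fun x => U (x + h) s) (spatialDeriv U (x + h) s) x := by
  have hd := ae_hasDerivAt_of_absolutelyContinuous (hU.absolutelyContinuous s)
  have hd' := (measurePreserving_add_right volume h).quasiMeasurePreserving.ae hd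
  filter_upwards [hd, hd'] with x h1 h2
  have h3 : HasDerivAt (fun x => U (x + h) s) (spatialDeriv U (x + h) s) x :=
    h2.comp_add_const x h
  exact ⟨(h3.sub h1).div_const h, h3⟩

theorem integral_spaceIntegrand (hU : HasFiniteEnergy U Q) (hb : ContDiff ℝ 1 b) (hε : 0 < ε)
    {R s : ℝ} (hp : -R ≤ p s) (hq : q s ≤ R) :
    IntegrableOn (fun x => spaceIntegrand b ε h p q U x s) (Icc (-R) R) ∧
      ∫ x in Icc (-R) R, spaceIntegrand b ε h p q U x s = 0 := by
  rcases lt_or_ge R (-R) with hR | hR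
  · rw [Icc_eq_empty (not_le.2 hR)]; simp
  have hac : AbsolutelyContinuousOnInterval (fun x => strip ε p q x s
      * b (fwdQuot h (fun y => U y s) x, s) * U (x + h) s) (-R) R := by
    refine AbsolutelyContinuousOnInterval.fun_mul (AbsolutelyContinuousOnInterval.fun_mul ?_ ?_) ?_
    · exact (contDiff_strip_space (n := 1) s).contDiffOn.absolutelyContinuousOnInterval
    · exact (hU.absolutelyContinuous_fwdQuot h s (-R) R).comp_contDiff (Φ := fun v => b (v, s))
        (hb.comp (contDiff_id.prodMk contDiff_const))
    · exact (hU.absolutelyContinuous s _ _).comp_add_right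
  have hd : ∀ᵐ x, x ∈ uIoc (-R) R → HasDerivAt (fun x => strip ε p q x s
      * b (fwdQuot h (fun y => U y s) x, s) * U (x + h) s) (spaceIntegrand b ε h p q U x s) x := by
    filter_upwards [hU.ae_hasDerivAt_fwdQuot h s] with x hx _
    have hbd : HasFDerivAt b (fderiv ℝ b (fwdQuot h (fun y => U y s) x, s))
        (fwdQuot h (fun y => U y s) x, s) := (hb.differentiable (by simp) _).hasFDerivAt
    have h1 := hbd.comp_hasDerivAt x (hx.1.prodMk (hasDerivAt_const x s))
    rw [fderiv_apply_eq, mul_zero, add_zero] at h1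
    exact ((hasDerivAt_strip_space x s).mul h1).mul hx.2
  refine ⟨?_, ?_⟩
  · have := hac.intervalIntegrable_of_ae_hasDerivAt hd
    rwa [intervalIntegrable_iff_integrableOn_Icc_of_le hR] at this
  · rw [integral_Icc_eq_integral_Ioc, ← intervalIntegral.integral_of_le hR,
      hac.integral_eq_sub_of_ae_hasDerivAt hd, strip_eq_zero hε fun hx => by linarith [hx.2],
      strip_eq_zero hε fun hx => by linarith [hx.1]]
    ring

/-- For almost every x the integrated equation holds at both x and x + h. Then w_h(x, ·) is
absolutely continuous, and the chain rule and the fundamental theorem of calculus apply in time. -/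
theorem ae_integral_timeIntegrand (hU : HasFiniteEnergy U Q) (hw : IsWeakProductSolution U)
    (hτ : 0 < τ) (hb : ContDiff ℝ 1 b) (hp : IsLipschitzPath U τ p) (hq : IsLipschitzPath U τ q) :
    ∀ᵐ x, ∫ s in (0 : ℝ)..τ, timeIntegrand b ε h p q U x s
      = strip ε p q x τ * b (fwdQuot h (fun y => U y τ) x, τ)
        - strip ε p q x 0 * b (fwdQuot h (fun y => U y 0) x, 0) := by
  have he := hU.ae_forall_eq_add_integral hw hτ
  have he' := (measurePreserving_add_right volume h).quasiMeasurePreserving.ae he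
  filter_upwards [he, he'] with x h1 h2
  have h1i : IntervalIntegrable (fun s => timeRate U x s) volume 0 τ := h1.1
  have h2i : IntervalIntegrable (fun s => timeRate U (x + h) s) volume 0 τ := h2.1
  have hgi : IntervalIntegrable (fun s => fwdQuot h (fun y => timeRate U y s) x) volume 0 τ :=
    (h2i.sub h1i).div_const h
  have hve : ∀ t ∈ Icc 0 τ, fwdQuot h (fun y => U y t) x = fwdQuot h (fun y => U y 0) x
      + ∫ s in (0 : ℝ)..t, fwdQuot h (fun y => timeRate U y s) x := fun t ht => by
    have hsub : uIcc 0 t ⊆ uIcc 0 τ := by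
      rw [uIcc_of_le ht.1, uIcc_of_le hτ.le]; exact Icc_subset_Icc_right ht.2
    have e1 := h1.2 t ht
    have e2 := h2.2 t ht
    simp only [fwdQuot]
    rw [intervalIntegral.integral_div, intervalIntegral.integral_sub (h2i.mono_set hsub)
      (h1i.mono_set hsub), e1, e2]
    ring
  have hvac : AbsolutelyContinuousOnInterval (fun s => fwdQuot h (fun y => U y s) x) 0 τ :=
    absolutelyContinuousOnInterval_of_integral hgi (by rwa [uIcc_of_le hτ.le])
  have hvd := ae_hasDerivAt_of_integral hτ.le hgi hve
  have hidac : AbsolutelyContinuousOnInterval (fun s : ℝ => s) 0 τ :=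
    contDiff_id.contDiffOn.absolutelyContinuousOnInterval
  have hac := (absolutelyContinuous_strip_time (ε := ε) hp hq x 0 τ).fun_mul
    ((hvac.prodMk hidac).comp_contDiff hb)
  have hmem : ∀ᵐ s : ℝ, s ≠ τ := Measure.ae_ne volume τ
  refine hac.integral_eq_sub_of_ae_hasDerivAt ?_
  filter_upwards [hvd, hp.hasDerivAt, hq.hasDerivAt, hmem] with s hv hps hqs hsτ hs
  rw [uIoc_of_le hτ.le] at hs
  have hs' : s ∈ Ioo 0 τ := ⟨hs.1, lt_of_le_of_ne hs.2 hsτ⟩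
  have hbd : HasFDerivAt b (fderiv ℝ b (fwdQuot h (fun y => U y s) x, s))
      (fwdQuot h (fun y => U y s) x, s) := (hb.differentiable (by simp) _).hasFDerivAt
  have hpair : HasDerivAt (fun r => (fwdQuot h (fun y => U y r) x, r))
      (fwdQuot h (fun y => timeRate U y s) x, 1) s := (hv hs').prodMk (hasDerivAt_id' s)
  have h3 := HasFDerivAt.comp_hasDerivAt
    (f := fun r => (fwdQuot h (fun y => U y r) x, r)) s hbd hpair
  rw [fderiv_apply_eq, mul_one] at h3
  exact (hasDerivAt_strip_time (hps hs') (hqs hs')).mul h3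

theorem continuous_fwdQuot_prod (hU : HasFiniteEnergy U Q) (h : ℝ) :
    Continuous fun z : ℝ × ℝ => fwdQuot h (fun y => U y z.2) z.1 := by
  have h1 : Continuous fun z : ℝ × ℝ => U (z.1 + h) z.2 :=
    hU.continuous.comp ((continuous_fst.add continuous_const).prodMk continuous_snd)
  have h2 := hU.continuous
  unfold fwdQuot
  fun_prop

theorem integrable_timeIntegrand_prod (hU : HasFiniteEnergy U Q) (hb : ContDiff ℝ 1 b)
    (hp : IsLipschitzPath U τ p) (hq : IsLipschitzPath U τ q) (R : ℝ) :
    Integrable (fun z : ℝ × ℝ => timeIntegrand b ε h p q U z.1 z.2)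
      ((volume.restrict (Icc (-R) R)).prod (volume.restrict (Icc 0 τ))) := by
  set μ := (volume.restrict (Icc (-R) R)).prod (volume.restrict (Icc 0 τ)) with hμ
  have hμ' : μ = (volume : Measure (ℝ × ℝ)).restrict (Icc (-R) R ×ˢ Icc 0 τ) := by
    rw [hμ, Measure.prod_restrict]; rfl
  have hK : IsCompact (Icc (-R) R ×ˢ Icc (0 : ℝ) τ) := isCompact_Icc.prod isCompact_Icc
  have hcont : ∀ F : ℝ × ℝ → ℝ, Continuous F → Integrable F μ := fun F hF => by
    rw [hμ']; exact hF.continuousOn.integrableOn_compact hK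
  have hmul : ∀ F G : ℝ × ℝ → ℝ, Continuous F → Integrable G μ →
      Integrable (fun z => F z * G z) μ := fun F G hF hG => by
    obtain ⟨B, hB⟩ := hK.exists_bound_of_continuousOn hF.continuousOn
    refine hG.bdd_mul (c := B) hF.aestronglyMeasurable ?_
    rw [hμ', ae_restrict_iff' hK.measurableSet]
    exact Eventually.of_forall hB
  have hv := hU.continuous_fwdQuot_prod h
  have hb0 : Continuous b := hb.continuous
  have hbf : Continuous (fderiv ℝ b) := hb.continuous_fderiv (by simp)
  have c0 := continuous_strip (ε := ε) hp.continuous hq.continuous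
  have c1 := continuous_stripDt (ε := ε) hp.continuous hq.continuous hU.continuous
  have c2 : Continuous fun z : ℝ × ℝ => b (fwdQuot h (fun y => U y z.2) z.1, z.2) := by fun_prop
  have c3 : Continuous fun z : ℝ × ℝ =>
      fderiv ℝ b (fwdQuot h (fun y => U y z.2) z.1, z.2) (1, 0) := by fun_prop
  have c4 : Continuous fun z : ℝ × ℝ =>
      fderiv ℝ b (fwdQuot h (fun y => U y z.2) z.1, z.2) (0, 1) := by fun_prop
  have hg1 := hU.integrable_timeRate_prod (-R) R 0 τ
  have hg2 : Integrable (fun z : ℝ × ℝ => timeRate U (z.1 + h) z.2) μ := by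
    have h1 := hU.integrable_timeRate_prod (-R + h) (R + h) 0 τ
    have hmp : MeasurePreserving (fun z : ℝ × ℝ => (z.1 + h, z.2)) μ
        ((volume.restrict (Icc (-R + h) (R + h))).prod (volume.restrict (Icc 0 τ))) := by
      have hshift : MeasurePreserving (fun x : ℝ => x + h) (volume.restrict (Icc (-R) R))
          (volume.restrict (Icc (-R + h) (R + h))) := by
        have := (measurePreserving_add_right volume h).restrict_preimage
            (measurableSet_Icc (a := -R + h) (b := R + h))
        simpa using this
      exact hshift.prod (MeasurePreserving.id _)
    exact hmp.integrable_comp_of_integrable h1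
  have hg : Integrable (fun z : ℝ × ℝ => fwdQuot h (fun y => timeRate U y z.2) z.1) μ :=
    (hg2.sub hg1).div_const h
  exact (hcont _ (c1.mul c2)).add (hmul _ _ c0 ((hmul _ _ c3 hg).add (hcont _ c4)))

/-- The renormalized mass of the strip at time `s`. -/
noncomputable def _root_.stripMass (b : ℝ × ℝ → ℝ) (ε h : ℝ) (p q : ℝ → ℝ) (U : ℝ → ℝ → ℝ)
    (R s : ℝ) : ℝ :=
  ∫ x in Icc (-R) R, strip ε p q x s * b (fwdQuot h (fun y => U y s) x, s)

/-- Fubini turns the increments on vertical lines into a time integral over horizontal slices. On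
each slice the flux derivative integrates to zero and can be added freely, which leaves only edge
errors and the residual. -/
theorem enorm_stripMass_sub_le (hU : HasFiniteEnergy U Q) (hw : IsWeakProductSolution U)
    (hτ : 0 < τ) (hb : ContDiff ℝ 1 b) (hp : IsLipschitzPath U τ p) (hq : IsLipschitzPath U τ q)
    (hε : 0 < ε) (hh : 0 < h) {R : ℝ} (hpR : ∀ s ∈ Icc 0 τ, -R ≤ p s) (hqR : ∀ s ∈ Icc 0 τ, q s ≤ R)
    {C ρ : ℝ} (hC : 0 ≤ C) (hρ : 0 ≤ ρ) (hbC : ∀ v, ∀ s ∈ Icc 0 τ, |b (v, s)| ≤ C)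
    (hρp : ∀ s ∈ Icc 0 τ, ∀ y, |y - p s| ≤ ε + h → |U y s - U (p s) s| ≤ ρ)
    (hρq : ∀ s ∈ Icc 0 τ, ∀ y, |y - q s| ≤ ε + h → |U y s - U (q s) s| ≤ ρ) :
    ‖stripMass b ε h p q U R τ - stripMass b ε h p q U R 0‖ₑ
      ≤ ENNReal.ofReal (2 * C * ρ) * ENNReal.ofReal τ
        + ∫⁻ s in Icc 0 τ, ∫⁻ x in Icc (-R) R, ‖residualAt b h U x s‖ₑ := by
  have hJ := hU.integrable_timeIntegrand_prod (ε := ε) (h := h) hb hp hq R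
  have hci : ∀ s, IntegrableOn (fun x => strip ε p q x s
      * b (fwdQuot h (fun y => U y s) x, s)) (Icc (-R) R) := fun s => by
    refine ContinuousOn.integrableOn_compact isCompact_Icc (Continuous.continuousOn ?_)
    have hv := hU.continuous_fwdQuot_prod h
    have hb0 : Continuous b := hb.continuous
    have c0 := continuous_strip (ε := ε) hp.continuous hq.continuous
    have c2 : Continuous fun z : ℝ × ℝ => b (fwdQuot h (fun y => U y z.2) z.1, z.2) := by fun_prop
    exact (c0.mul c2).comp (by fun_prop : Continuous fun x : ℝ => (x, s))
  have e1 : stripMass b ε h p q U R τ - stripMass b ε h p q U R 0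
      = ∫ s in Icc 0 τ, ∫ x in Icc (-R) R, timeIntegrand b ε h p q U x s := by
    rw [stripMass, stripMass, ← integral_sub (hci τ) (hci 0), ← integral_integral_swap hJ]
    refine integral_congr_ae (ae_restrict_of_ae ?_)
    filter_upwards [hU.ae_integral_timeIntegrand (ε := ε) (h := h) hw hτ hb hp hq] with x hx
    rw [← hx, intervalIntegral.integral_of_le hτ.le, integral_Icc_eq_integral_Ioc]
  rw [e1]
  refine (enorm_integral_le_lintegral_enorm _).trans ?_
  have hae : ∀ᵐ s ∂(volume.restrict (Icc 0 τ)),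
      ‖∫ x in Icc (-R) R, timeIntegrand b ε h p q U x s‖ₑ
        ≤ ENNReal.ofReal (2 * C * ρ) + ∫⁻ x in Icc (-R) R, ‖residualAt b h U x s‖ₑ := by
    filter_upwards [hJ.prod_left_ae, ae_restrict_mem measurableSet_Icc] with s hs hsm
    obtain ⟨hX, hX0⟩ := hU.integral_spaceIntegrand (h := h) hb hε (hpR s hsm) (hqR s hsm)
    have e2 : ∫ x in Icc (-R) R, timeIntegrand b ε h p q U x s
        = ∫ x in Icc (-R) R, (timeIntegrand b ε h p q U x s + spaceIntegrand b ε h p q U x s) := by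
      rw [integral_add hs hX, hX0, add_zero]
    rw [e2]
    refine (enorm_integral_le_lintegral_enorm _).trans ?_
    have hm : Measurable fun x => b (fwdQuot h (fun y => U y s) x, s)
        * (stripDt ε p q U x s + stripDx ε p q x s * U (x + h) s) := by
      have hv : Continuous fun x => fwdQuot h (fun y => U y s) x :=
        (hU.continuous_fwdQuot_prod h).comp (by fun_prop : Continuous fun x : ℝ => (x, s))
      have hb0 : Continuous b := hb.continuous
      have c1 : Continuous fun x => stripDt ε p q U x s :=
        (continuous_stripDt (ε := ε) hp.continuous hq.continuous hU.continuous).comp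
          (by fun_prop : Continuous fun x : ℝ => (x, s))
      have c2 : Continuous fun x => stripDx ε p q x s :=
        (continuous_stripDx (ε := ε) hp.continuous hq.continuous).comp
          (by fun_prop : Continuous fun x : ℝ => (x, s))
      have c3 := hU.continuous_space s
      exact Continuous.measurable (by fun_prop)
    calc ∫⁻ x in Icc (-R) R, ‖timeIntegrand b ε h p q U x s + spaceIntegrand b ε h p q U x s‖ₑ
        ≤ ∫⁻ x in Icc (-R) R, (‖b (fwdQuot h (fun y => U y s) x, s)
            * (stripDt ε p q U x s + stripDx ε p q x s * U (x + h) s)‖ₑ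
              + ‖residualAt b h U x s‖ₑ) := by
          refine lintegral_mono fun x => ?_
          rw [hU.timeIntegrand_add_spaceIntegrand]
          refine (enorm_add_le _ _).trans (add_le_add le_rfl ?_)
          rw [enorm_mul]
          refine mul_le_of_le_one_left' ?_
          rw [Real.enorm_of_nonneg (strip_nonneg _ _)]
          exact ENNReal.ofReal_le_one.2 (strip_le_one _ _)
      _ = (∫⁻ x in Icc (-R) R, ‖b (fwdQuot h (fun y => U y s) x, s)
            * (stripDt ε p q U x s + stripDx ε p q x s * U (x + h) s)‖ₑ)
          + ∫⁻ x in Icc (-R) R, ‖residualAt b h U x s‖ₑ := lintegral_add_left hm.enorm _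
      _ ≤ _ := add_le_add (lintegral_stripDt_add_le hε hh.le hρ hC (hρp s hsm) (hρq s hsm)
            (fun x => hbC _ s hsm) _) le_rfl
  refine (lintegral_mono_ae hae).trans ?_
  rw [lintegral_add_left measurable_const, setLIntegral_const, Real.volume_Icc, sub_zero]

end HasFiniteEnergy

/-- A bounded `C¹` renormalization function on `[0, τ]`, transported by `w' = -w² / 2` up to the
compression factor. -/
structure IsRenormalization (b : ℝ × ℝ → ℝ) (τ C : ℝ) : Prop where
  contDiff : ContDiff ℝ 1 b
  transport : ∀ v s, fderiv ℝ b (v, s) (-v ^ 2 / 2, 1) = -v * b (v, s)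
  bound : ∀ v, ∀ s ∈ Icc 0 τ, |b (v, s)| ≤ C
  bound_deriv : ∀ v, ∀ s ∈ Ioo 0 τ, |fderiv ℝ b (v, s) (1, 0)| ≤ C ∧
    |fderiv ℝ b (v, s) (0, 1)| ≤ C

/-! ### The limit h → 0 and the choice of renormalization -/

namespace HasFiniteEnergy

variable {U : ℝ → ℝ → ℝ} {Q : ℝ≥0∞} {b : ℝ × ℝ → ℝ} {C τ : ℝ} {p q : ℝ → ℝ}

theorem measurable_residualAt (hU : HasFiniteEnergy U Q) (hb : ContDiff ℝ 1 b) (h : ℝ) :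
    Measurable fun z : ℝ × ℝ => residualAt b h U z.1 z.2 := by
  have hv := (hU.continuous_fwdQuot_prod h).measurable
  have hb0 : Continuous b := hb.continuous
  have hbf : Continuous (fderiv ℝ b) := hb.continuous_fderiv (by simp)
  have m1 : Measurable fun z : ℝ × ℝ => b (fwdQuot h (fun y => U y z.2) z.1, z.2) :=
    hb0.measurable.comp (hv.prodMk measurable_snd)
  have m2 : Measurable fun z : ℝ × ℝ =>
      fderiv ℝ b (fwdQuot h (fun y => U y z.2) z.1, z.2) (1, 0) :=
    (by fun_prop : Continuous fun z => fderiv ℝ b z (1, 0)).measurable.comp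
      (hv.prodMk measurable_snd)
  have m3 : Measurable fun z : ℝ × ℝ =>
      fderiv ℝ b (fwdQuot h (fun y => U y z.2) z.1, z.2) (0, 1) :=
    (by fun_prop : Continuous fun z => fderiv ℝ b z (0, 1)).measurable.comp
      (hv.prodMk measurable_snd)
  have m4 : Measurable fun z : ℝ × ℝ => deriv (fun y => U y z.2) z.1 := hU.measurable_spatialDeriv
  have hshift : Measurable fun z : ℝ × ℝ => (z.1 + h, z.2) := by fun_prop
  have m5 : Measurable fun z : ℝ × ℝ => deriv (fun y => U y z.2) (z.1 + h) := m4.comp hshift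
  have m6 : Measurable fun z : ℝ × ℝ => fwdMeanSq h (deriv fun y => U y z.2) z.1 := by
    have h1 := ((hU.measurable_leftEnergy.comp hshift).sub hU.measurable_leftEnergy).div_const h
    convert h1 using 2 with z
    exact (hU.leftEnergy_sub h z.1 z.2).symm
  unfold residualAt renormResidual
  fun_prop

/-- Dominated convergence in time on top of the limit at each fixed time. The endpoints, where the
derivatives of b have no assumed bound, form a null set. -/
theorem tendsto_lintegral_residualAt (hU : HasFiniteEnergy U Q) (hb : IsRenormalization b τ C)
    {h : ℕ → ℝ} (hh : ∀ n, 0 < h n) (hlim : Tendsto h atTop (𝓝 0)) (R : ℝ) :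
    Tendsto (fun n => ∫⁻ s in Icc 0 τ, ∫⁻ x in Icc (-R) R, ‖residualAt b (h n) U x s‖ₑ) atTop
      (𝓝 0) := by
  have hb0 : Continuous b := hb.contDiff.continuous
  have hbf : Continuous (fderiv ℝ b) := hb.contDiff.continuous_fderiv (by simp)
  have hae : ∀ᵐ s ∂(volume.restrict (Icc 0 τ)), s ∈ Ioo 0 τ := by
    rw [← Measure.restrict_congr_set Ioo_ae_eq_Icc]
    exact ae_restrict_mem measurableSet_Ioo
  have c1 : ∀ s, Continuous fun v => b (v, s) := fun s => by fun_prop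
  have c2 : ∀ s, Continuous fun v => fderiv ℝ b (v, s) (1, 0) := fun s => by fun_prop
  have c3 : ∀ s, Continuous fun v => fderiv ℝ b (v, s) (0, 1) := fun s => by fun_prop
  have h0 : Tendsto (fun n => ∫⁻ s in Icc 0 τ, ∫⁻ x in Icc (-R) R, ‖residualAt b (h n) U x s‖ₑ)
      atTop (𝓝 (∫⁻ _ in Icc 0 τ, 0)) := by
    refine tendsto_lintegral_of_dominated_convergence (fun _ => residualBound C R Q)
      (fun n => ?_) (fun n => ?_) ?_ ?_
    · exact Measurable.lintegral_prod_left' (hU.measurable_residualAt hb.contDiff (h n)).enorm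
    · filter_upwards [hae] with s hs
      exact lintegral_renormResidual_le_bound (hU.continuous_space s)
        (hU.absolutelyContinuous s) (hU.memLp s) (c1 s) (c2 s) (c3 s)
        (fun v => hb.bound v s (Ioo_subset_Icc_self hs)) (fun v => (hb.bound_deriv v s hs).1)
        (fun v => (hb.bound_deriv v s hs).2) (hh n) R (hU.energy_le s)
    · rw [setLIntegral_const]
      exact (ENNReal.mul_lt_top (residualBound_lt_top hU.lt_top) measure_Icc_lt_top).ne
    · filter_upwards [hae] with s hs
      refine tendsto_lintegral_renormResidual (hU.continuous_space s)
        (hU.absolutelyContinuous s) (hU.memLp s) (c1 s) (c2 s) (c3 s)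
        (fun v => hb.bound v s (Ioo_subset_Icc_self hs)) (fun v => (hb.bound_deriv v s hs).1)
        (fun v => (hb.bound_deriv v s hs).2) (fun v => ?_) hh hlim R
      have := hb.transport v s
      rw [fderiv_apply_eq] at this
      linarith
  simpa using h0

/-- The cut-off width and the quotient step are the same sequence. Boundedness of b makes the
constant C a majorant on the bounded interval. -/
theorem tendsto_stripMass (hU : HasFiniteEnergy U Q) (hb : IsRenormalization b τ C)
    (hp : IsLipschitzPath U τ p) (hq : IsLipschitzPath U τ q)
    {h : ℕ → ℝ} (hh : ∀ n, 0 < h n) (hlim : Tendsto h atTop (𝓝 0)) {R s : ℝ} (hs : s ∈ Icc 0 τ)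
    (hpR : -R ≤ p s) (hqR : q s ≤ R) :
    Tendsto (fun n => stripMass b (h n) (h n) p q U R s) atTop
      (𝓝 (∫ x in Ioo (p s) (q s), b (spatialDeriv U x s, s))) := by
  have hb0 : Continuous b := hb.contDiff.continuous
  have hlim' : Tendsto h atTop (𝓝[>] 0) :=
    tendsto_nhdsWithin_iff.2 ⟨hlim, Eventually.of_forall hh⟩
  have hsub : Ioo (p s) (q s) ⊆ Icc (-R) R := fun x hx =>
    ⟨hpR.trans hx.1.le, hx.2.le.trans hqR⟩
  have e : ∫ x in Ioo (p s) (q s), b (spatialDeriv U x s, s)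
      = ∫ x in Icc (-R) R, (Ioo (p s) (q s)).indicator (fun x => b (spatialDeriv U x s, s)) x := by
    rw [setIntegral_indicator measurableSet_Ioo, inter_eq_self_of_subset_right hsub]
  rw [e]
  refine tendsto_integral_of_dominated_convergence (fun _ => C) (fun n => ?_)
    (integrable_const C) (fun n => Eventually.of_forall fun x => ?_) ?_
  · have hv := hU.continuous_fwdQuot_prod (h n)
    have c0 := continuous_strip (ε := h n) hp.continuous hq.continuous
    have c2 : Continuous fun z : ℝ × ℝ => b (fwdQuot (h n) (fun y => U y z.2) z.1, z.2) := by
      fun_prop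
    exact ((c0.mul c2).comp (by fun_prop : Continuous fun x : ℝ => (x, s))).aestronglyMeasurable
  · rw [norm_mul, Real.norm_of_nonneg (strip_nonneg _ _)]
    exact (mul_le_of_le_one_left (norm_nonneg _) (strip_le_one _ _)).trans (hb.bound _ s hs)
  · refine ae_restrict_of_ae ?_
    filter_upwards [ae_hasDerivAt_of_absolutelyContinuous (hU.absolutelyContinuous s)] with x hx
    have h1 : Tendsto (fun n => b (fwdQuot (h n) (fun y => U y s) x, s)) atTop
        (𝓝 (b (spatialDeriv U x s, s))) :=
      ((by fun_prop : Continuous fun v => b (v, s)).tendsto _).comp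
        ((tendsto_fwdQuot hx).comp hlim')
    by_cases hxs : x ∈ Ioo (p s) (q s)
    · rw [indicator_of_mem hxs]
      refine h1.congr' ?_
      filter_upwards [hlim.eventually_lt_const (sub_pos.2 hxs.1),
        hlim.eventually_lt_const (sub_pos.2 hxs.2)] with n hn1 hn2
      rw [strip, smoothCut_of_ge (hh n) hn1.le, smoothCut_of_ge (hh n) hn2.le, one_mul, one_mul]
    · rw [indicator_of_notMem hxs]
      refine tendsto_const_nhds.congr fun n => ?_
      rw [strip_eq_zero (hh n) hxs, zero_mul]

/-- Uniform continuity of u on a compact neighbourhood of the graph of the path. -/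
theorem exists_uniform_modulus (hU : HasFiniteEnergy U Q) (hp : Continuous p) {δ : ℝ}
    (hδ : 0 < δ) : ∃ κ > 0, ∀ s ∈ Icc 0 τ, ∀ y, |y - p s| ≤ κ → |U y s - U (p s) s| ≤ δ := by
  obtain ⟨B, hB⟩ := isCompact_Icc.exists_bound_of_continuousOn (hp.continuousOn (s := Icc 0 τ))
  have hK : IsCompact (Icc (-(B + 1)) (B + 1) ×ˢ Icc (0 : ℝ) τ) := isCompact_Icc.prod isCompact_Icc
  have huc := hK.uniformContinuousOn_of_continuous hU.continuous.continuousOn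
  obtain ⟨κ, hκ, H⟩ := Metric.uniformContinuousOn_iff.1 huc δ hδ
  refine ⟨min (κ / 2) 1, by positivity, fun s hs y hy => ?_⟩
  have h1 := abs_le.1 (hB s hs)
  have h2 := abs_le.1 (hy.trans (min_le_right _ _))
  have h3 := hy.trans (min_le_left _ _)
  refine (H (y, s) ⟨⟨by linarith, by linarith⟩, hs⟩ (p s, s) ⟨⟨by linarith, by linarith⟩, hs⟩
    ?_).le
  rw [Prod.dist_eq, dist_self, Real.dist_eq]
  exact max_lt (by linarith) hκ

/-- The limit h → 0 at a fixed modulus δ removes the residual and leaves an edge error proportional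
to δ; then δ → 0. -/
theorem integral_renorm_eq (hU : HasFiniteEnergy U Q) (hw : IsWeakProductSolution U)
    (hτ : 0 < τ) (hb : IsRenormalization b τ C) (hp : IsLipschitzPath U τ p)
    (hq : IsLipschitzPath U τ q) :
    ∫ x in Ioo (p τ) (q τ), b (spatialDeriv U x τ, τ)
      = ∫ x in Ioo (p 0) (q 0), b (spatialDeriv U x 0, 0) := by
  obtain ⟨B₁, hB₁⟩ := isCompact_Icc.exists_bound_of_continuousOn
    (hp.continuous.continuousOn (s := Icc 0 τ))
  obtain ⟨B₂, hB₂⟩ := isCompact_Icc.exists_bound_of_continuousOn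
    (hq.continuous.continuousOn (s := Icc 0 τ))
  set R := max B₁ B₂
  have hpR : ∀ s ∈ Icc 0 τ, -R ≤ p s := fun s hs =>
    (neg_le_neg (le_max_left B₁ B₂)).trans (abs_le.1 (hB₁ s hs)).1
  have hqR : ∀ s ∈ Icc 0 τ, q s ≤ R := fun s hs =>
    (abs_le.1 (hB₂ s hs)).2.trans (le_max_right B₁ B₂)
  have hC : 0 ≤ C := (abs_nonneg _).trans (hb.bound 0 0 ⟨le_rfl, hτ.le⟩)
  set h : ℕ → ℝ := fun n => 1 / ((n : ℝ) + 1) with hh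
  have hpos : ∀ n, 0 < h n := fun n => by simp only [hh]; positivity
  have hlim : Tendsto h atTop (𝓝 0) := tendsto_one_div_add_atTop_nhds_zero_nat
  have hm := ((hU.tendsto_stripMass hb hp hq hpos hlim ⟨hτ.le, le_rfl⟩
    (hpR τ ⟨hτ.le, le_rfl⟩) (hqR τ ⟨hτ.le, le_rfl⟩)).sub
    (hU.tendsto_stripMass hb hp hq hpos hlim ⟨le_rfl, hτ.le⟩
      (hpR 0 ⟨le_rfl, hτ.le⟩) (hqR 0 ⟨le_rfl, hτ.le⟩))).enorm
  have hres := hU.tendsto_lintegral_residualAt hb hpos hlim R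
  set L := (∫ x in Ioo (p τ) (q τ), b (spatialDeriv U x τ, τ))
    - ∫ x in Ioo (p 0) (q 0), b (spatialDeriv U x 0, 0) with hL
  have hbd : ∀ δ > 0, ‖L‖ₑ ≤ ENNReal.ofReal (2 * C * δ) * ENNReal.ofReal τ := by
    intro δ hδ
    have hlim2 := hres.const_add (ENNReal.ofReal (2 * C * δ) * ENNReal.ofReal τ)
    rw [add_zero] at hlim2
    refine le_of_tendsto_of_tendsto hm hlim2 ?_
    obtain ⟨κ₁, hκ₁, H₁⟩ := hU.exists_uniform_modulus (τ := τ) hp.continuous hδ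
    obtain ⟨κ₂, hκ₂, H₂⟩ := hU.exists_uniform_modulus (τ := τ) hq.continuous hδ
    filter_upwards [hlim.eventually_lt_const (half_pos hκ₁),
      hlim.eventually_lt_const (half_pos hκ₂)] with n hn1 hn2
    exact hU.enorm_stripMass_sub_le hw hτ hb.contDiff hp hq (hpos n) (hpos n) hpR hqR hC hδ.le
      hb.bound (fun s hs y hy => H₁ s hs y (by linarith)) fun s hs y hy => H₂ s hs y (by linarith)
  have hL0 : ‖L‖ₑ ≤ 0 := by
    have ht : Tendsto (fun δ : ℝ => ENNReal.ofReal (2 * C * δ) * ENNReal.ofReal τ) (𝓝[>] 0)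
        (𝓝 (ENNReal.ofReal (2 * C * 0) * ENNReal.ofReal τ)) := by
      refine ENNReal.Tendsto.mul_const ?_ (Or.inr ENNReal.ofReal_ne_top)
      refine (ENNReal.continuous_ofReal.tendsto _).comp ?_
      exact ((continuous_const_mul (2 * C)).tendsto 0).mono_left nhdsWithin_le_nhds
    rw [mul_zero, ENNReal.ofReal_zero, zero_mul] at ht
    refine ge_of_tendsto ht ?_
    filter_upwards [self_mem_nhdsWithin] with δ hδ using hbd δ hδ
  exact sub_eq_zero.1 (enorm_eq_zero.1 (le_antisymm hL0 zero_le))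

/-- Each conserved integral is at most the energy at time τ because b ≤ v². At time 0 the same
inequality provides the majorant w² for the passage to the limit in n. -/
theorem integral_surviving_le (hU : HasFiniteEnergy U Q) (hw : IsWeakProductSolution U)
    (hτ : 0 < τ) (hp : IsLipschitzPath U τ p) (hq : IsLipschitzPath U τ q) :
    ∫ x in {x | spatialDeriv U x 0 > -2 / τ} ∩ Ioo (p 0) (q 0), spatialDeriv U x 0 ^ 2
      ≤ ∫ x in Ioo (p τ) (q τ), spatialDeriv U x τ ^ 2 := by
  have hWm : Measurable fun x => spatialDeriv U x 0 := measurable_deriv _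
  set b : ℕ → ℝ × ℝ → ℝ := fun n => renormFn (2 / τ * (1 - 1 / ((n : ℝ) + 2))) ((n : ℝ) + 1)
    ((n : ℝ) + 1) with hb
  have hc : ∀ n : ℕ, 0 < (n : ℝ) + 1 := fun n => by positivity
  have hfrac : ∀ n : ℕ, 1 / ((n : ℝ) + 2) < 1 := fun n => by
    rw [div_lt_one (by positivity)]
    linarith [hc n]
  have hmpos : ∀ n : ℕ, 0 < 2 / τ * (1 - 1 / ((n : ℝ) + 2)) := fun n =>
    mul_pos (by positivity) (sub_pos.2 (hfrac n))
  have hcont : ∀ n, Continuous (b n) := fun n =>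
    (contDiff_renormFn (hmpos n) (hc n) (hc n)).continuous
  have hle : ∀ n, ∫ x in Ioo (p 0) (q 0), b n (spatialDeriv U x 0, 0)
      ≤ ∫ x in Ioo (p τ) (q τ), spatialDeriv U x τ ^ 2 := fun n => by
    have hmτ : 2 / τ * (1 - 1 / ((n : ℝ) + 2)) * τ < 2 := by
      have : 2 / τ * (1 - 1 / ((n : ℝ) + 2)) * τ = 2 * (1 - 1 / ((n : ℝ) + 2)) := by field_simp
      rw [this]
      have : 0 < 1 / ((n : ℝ) + 2) := by positivity
      linarith
    obtain ⟨C, hC1, hC2⟩ := exists_bound_renormFn (hmpos n) (hc n) (hc n) hmτ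
    have hbn : IsRenormalization (b n) τ C := ⟨contDiff_renormFn (hmpos n) (hc n) (hc n),
      fun v s => fderiv_renormFn (hmpos n) (hc n) (hc n) v s, hC1, hC2⟩
    rw [← hU.integral_renorm_eq hw hτ hbn hp hq]
    refine integral_mono_of_nonneg (Eventually.of_forall fun x => renormFn_nonneg (hc n) _)
      (hU.integrable_sq τ).integrableOn (Eventually.of_forall fun x => ?_)
    exact renormFn_le_sq (hc n) (spatialDeriv U x τ, τ)
  have hS : MeasurableSet {x | spatialDeriv U x 0 > -2 / τ} := measurableSet_lt measurable_const hWm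
  have hlim : Tendsto (fun n => ∫ x in Ioo (p 0) (q 0), b n (spatialDeriv U x 0, 0)) atTop
      (𝓝 (∫ x in Ioo (p 0) (q 0),
        {x | spatialDeriv U x 0 > -2 / τ}.indicator (fun x => spatialDeriv U x 0 ^ 2) x)) := by
    refine tendsto_integral_of_dominated_convergence (fun x => spatialDeriv U x 0 ^ 2)
      (fun n => ?_) (hU.integrable_sq 0).integrableOn
      (fun n => Eventually.of_forall fun x => ?_) (Eventually.of_forall fun x => ?_)
    · exact ((hcont n).measurable.comp (hWm.prodMk measurable_const)).aestronglyMeasurable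
    · rw [Real.norm_of_nonneg (renormFn_nonneg (hc n) _)]
      exact renormFn_le_sq (hc n) (spatialDeriv U x 0, 0)
    · exact tendsto_renormFn_zero hτ (spatialDeriv U x 0)
  rw [setIntegral_indicator hS, inter_comm] at hlim
  exact le_of_tendsto' hlim hle

end HasFiniteEnergy

/-! ### The main result -/

/-- Freezing u at its initial value for negative times makes it continuous on the whole plane
without changing it for t ≥ 0. The bound then holds at every time, including the prescribed times 0
and t. -/
theorem IsHunterSaxtonWeakSolution.hasFiniteEnergy {u : ℝ → ℝ → ℝ} {u₀ w₀ : ℝ → ℝ}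
    (hu : IsHunterSaxtonWeakSolution u u₀ w₀) :
    ∃ Q, HasFiniteEnergy (fun x t => u x (max t 0)) Q := by
  obtain ⟨C, hC⟩ := hu.deriv_bounded
  have hc : Continuous fun z : ℝ × ℝ => u z.1 (max z.2 0) :=
    hu.continuous.comp_continuous (f := fun z : ℝ × ℝ => (z.1, max z.2 0)) (by fun_prop)
      fun z => show (0 : ℝ) ≤ max z.2 0 from le_max_right _ _
  have hac : ∀ t a b, AbsolutelyContinuousOnInterval (fun x => u x (max t 0)) a b := fun t a b =>
    hu.absolutelyContinuous_space _ (le_max_right _ _) a b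
  have hQ : (C : ℝ≥0∞) ^ 2 < ⊤ := ENNReal.pow_lt_top ENNReal.coe_lt_top
  refine ⟨(C : ℝ≥0∞) ^ 2, hc, hac, fun t => ?_, hQ⟩
  have h1 : ∀ᵐ t : ℝ, 0 ≤ t →
      ∫⁻ x, ‖spatialDeriv (fun x t => u x (max t 0)) x t‖ₑ ^ 2 ≤ (C : ℝ≥0∞) ^ 2 := by
    filter_upwards [(ae_restrict_iff' measurableSet_Ici).1 hC] with t ht ht0
    have h2 := (ht ht0).2
    rw [lintegral_enorm_sq_eq]
    have h3 : (fun x => spatialDeriv (fun x t => u x (max t 0)) x t)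
        = fun x => spatialDeriv u x t := by
      ext x; simp only [spatialDeriv, max_eq_left ht0]
    rw [h3]
    gcongr
  have h4 := energy_le_of_ae hQ hc hac h1 (le_max_right t 0)
  simpa [spatialDeriv] using h4

theorem HunterSaxtonDistributional.isWeakProductSolution {u : ℝ → ℝ → ℝ}
    (hu : HunterSaxtonDistributional u) :
    IsWeakProductSolution fun x t => u x (max t 0) := by
  intro χ η hχ hχc hη hηc hηs
  have hsub : tsupport (fun z : ℝ × ℝ => χ z.1 * η z.2) ⊆ tsupport χ ×ˢ tsupport η := by
    refine closure_minimal (fun z hz => ?_) ((isClosed_tsupport _).prod (isClosed_tsupport _))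
    exact ⟨subset_closure (left_ne_zero_of_mul hz), subset_closure (right_ne_zero_of_mul hz)⟩
  have h := hu (fun z => χ z.1 * η z.2)
    ((hχ.comp contDiff_fst).mul (hη.comp contDiff_snd))
    (HasCompactSupport.of_support_subset_isCompact (hχc.isCompact.prod hηc.isCompact)
      (subset_closure.trans hsub))
    (fun z hz => hηs (hsub hz).2)
  refine Eq.trans (setIntegral_congr_fun measurableSet_Ioi fun t ht => ?_) h
  have ht0 : max t 0 = t := max_eq_left (le_of_lt ht)
  have hdt : ∀ x, deriv (fun s => χ x * η s) t = χ x * deriv η t := fun x =>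
    deriv_const_mul_field _
  have hdx : ∀ x, deriv (fun y => χ y * η t) x = deriv χ x * η t := fun x =>
    deriv_mul_const_field _
  simp only [leftEnergy, spatialDeriv, ht0, hdt, hdx]

theorem IsCharacteristic.exists_isLipschitzPath {u : ℝ → ℝ → ℝ} {T x₀ t : ℝ} {x : ℝ → ℝ}
    (hx : IsCharacteristic u T x₀ x) (ht : 0 < t) (htT : t ≤ T) :
    ∃ p, IsLipschitzPath (fun x t => u x (max t 0)) t p ∧ p 0 = x₀ ∧ p t = x t := by
  obtain ⟨K, hK⟩ := hx.lipschitz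
  obtain ⟨p, hp, hpe⟩ := hK.extend_real
  refine ⟨p, ⟨⟨K, hp⟩, ?_⟩, ?_, ?_⟩
  · filter_upwards [(ae_restrict_iff' measurableSet_Icc).1 hx.hasDerivAt] with s hs hst
    have hsT : s ∈ Icc 0 T := ⟨hst.1.le, hst.2.le.trans htT⟩
    have h1 := hs hsT
    rw [hpe hsT] at h1
    rw [max_eq_left hst.1.le]
    refine h1.congr_of_eventuallyEq ?_
    filter_upwards [Ioo_mem_nhds hst.1 hst.2] with r hr
    exact (hpe ⟨hr.1.le, hr.2.le.trans htT⟩).symm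
  · rw [← hpe ⟨le_rfl, ht.le.trans htT⟩, hx.start]
  · exact (hpe ⟨ht.le, htT⟩).symm

theorem proposition2p3 (u : ℝ → ℝ → ℝ) (u₀ w₀ : ℝ → ℝ)
    (hu : IsHunterSaxtonWeakSolution u u₀ w₀)
    (ξ ζ : ℝ) (hξζ : ξ < ζ) (T : ℝ) (xξ xζ : ℝ → ℝ)
    (hxξ : IsCharacteristic u T ξ xξ) (hxζ : IsCharacteristic u T ζ xζ)
    (hle : ∀ s ∈ Icc 0 T, xξ s ≤ xζ s)
    (t : ℝ) (ht : 0 < t) (htT : t ≤ T) :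
    IntervalIntegrable (fun y => spatialDeriv u y t ^ 2) volume (xξ t) (xζ t) ∧
      ∫ y in (xξ t)..(xζ t), spatialDeriv u y t ^ 2
        ≥ ∫ z in survivingSet u₀ w₀ t ∩ Ioo ξ ζ, w₀ z ^ 2 := by
  obtain ⟨Q, hU⟩ := hu.hasFiniteEnergy
  obtain ⟨p, hp, hp0, hpt⟩ := hxξ.exists_isLipschitzPath ht htT
  obtain ⟨q, hq, hq0, hqt⟩ := hxζ.exists_isLipschitzPath ht htT
  have hdt : ∀ x, spatialDeriv (fun x t => u x (max t 0)) x t = spatialDeriv u x t := fun x => by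
    simp only [spatialDeriv, max_eq_left ht.le]
  have hd0 : ∀ᵐ x, HasDerivAt u₀ (w₀ x) x ∧
      spatialDeriv (fun x t => u x (max t 0)) x 0 = w₀ x := by
    filter_upwards [hu.initial_deriv] with x hx
    refine ⟨hx, ?_⟩
    simp only [spatialDeriv, max_self, hu.initial]
    exact hx.deriv
  have hmain := hU.integral_surviving_le hu.equation.isWeakProductSolution ht hp hq
  rw [hp0, hq0, hpt, hqt] at hmain
  simp only [hdt] at hmain
  have hi := hU.integrable_sq t
  simp only [hdt] at hi
  refine ⟨hi.intervalIntegrable, ?_⟩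
  rw [intervalIntegral.integral_of_le (hle t ⟨ht.le, htT⟩), integral_Ioc_eq_integral_Ioo]
  refine le_trans (le_of_eq ?_) hmain
  -- Differentiability of u₀ with derivative w₀ holds almost everywhere, so up to a null set only
  -- the inequality defines the surviving set.
  have hset : (survivingSet u₀ w₀ t ∩ Ioo ξ ζ : Set ℝ) =ᵐ[volume]
      ({x | spatialDeriv (fun x t => u x (max t 0)) x 0 > -2 / t} ∩ Ioo ξ ζ : Set ℝ) := by
    refine Filter.EventuallyEq.inter ?_ (ae_eq_refl _)
    filter_upwards [hd0] with x hx
    refine propext ?_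
    change (HasDerivAt u₀ (w₀ x) x ∧ w₀ x > -2 / t) ↔ _ > -2 / t
    rw [hx.2]
    exact and_iff_right hx.1
  rw [setIntegral_congr_set hset]
  refine integral_congr_ae (ae_restrict_of_ae ?_)
  filter_upwards [hd0] with x hx
  rw [hx.2]
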